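/- Let $d \ge 2$ be an integer, let $0<\sigma\le 1$ satisfy $\sigma\sqrt{\ln(4/\sigma)} \le \frac{1}{32d}$, and put $n = \lfloor (4/\sigma)^d \rfloor$. (1) There exist $\bar A \in \mathbb{R}^{n\times d}$ and $\bar b \in \mathbb{R}^n$ such that every row of the combined matrix $(\bar A,\bar b)$ has Euclidean norm at most $1$, the rows of $\sqrt2\,\bar A$ form a $\sigma$-dense subset $S$ of the unit sphere $\mathbb{S}^{d-1}$ (that is, $S\subset\mathbb{S}^{d-1}$, and for every $x\in\mathbb{S}^{d-1}$ there is $s\in S$ with $\|x-s\|\le\sigma$), $\sqrt2\,\bar b$ is the all-ones vector, and the following holds. Let $A, b$ have independent Gaussian entries with variance $\sigma^2$ and means $\mathbb{E}[A]=\bar A$, $\mathbb{E}[b]=\bar b$, and let $P=\{x\in\mathbb{R}^d : Ax\le b\}$. With probability at least $1-n^{-d}$, the combinatorial diameter of $P$ (the diameter of its graph of vertices and edges) is at least $$L=\frac{\sqrt{d-1}}{24\sqrt{\sigma\sqrt{\ln(4/\sigma)}}},$$ and, simultaneously for all nonzero $c\in\mathbb{R}^d$, the objective $c^\top x$ has a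 maximizing vertex and a minimizing vertex on $P$, and every maximizing vertex is at combinatorial distance at least $L$ from every minimizing vertex. (2) Let $\nu$ be any rotation-invariant probability distribution on $\mathbb{R}^d$ with $\nu(\{0\})=0$, and define the semi-random shadow size $$R(n,d,\sigma)=\sup_{\bar A,\bar b,c}\ \mathbb{E}_{A,b,Z}\Bigl[\#\,\text{vertices of } \pi_{\operatorname{span}(c,Z)}\bigl(\{x: Ax\le b\}\bigr)\Bigr],$$ where the supremum is over all $\bar A\in\mathbb{R}^{n\times d}$, $\bar b\in\mathbb{R}^n$ such that the rows of $(\bar A,\bar b)$ have norm at most $1$ and over all unit vectors $c$; $A,b$ are the Gaussian perturbations of $\bar A,\bar b$ with standard deviation $\sigma$ as in (1); $Z\sim\nu$ is independent of $(A,b)$; and $\pi_W$ denotes the orthogonal projection onto $W$. Then $$R(n,d,\sigma)\ \ge\ \frac{\sqrt{d-1}}{96\sqrt{\sigma\sqrt{\ln(4/\sigma)}}}.$$ -/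

import Mathlib

open MeasureTheory ProbabilityTheory
open scoped ENNReal

noncomputable section

/-- The polyhedron `{x ∈ ℝᵈ : A x ≤ b}`. -/
def polyhedron {n d : ℕ} (A : Fin n → Fin d → ℝ) (b : Fin n → ℝ) :
    Set (EuclideanSpace ℝ (Fin d)) :=
  {x | ∀ i, ∑ j, A i j * x j ≤ b i}

/-- The vertex-edge graph of a convex set `P`: its vertices are the extreme points of `P`, and two
distinct vertices are adjacent when the segment between them is a face of `P`. -/
def skeletonGraph {d : ℕ} (P : Set (EuclideanSpace ℝ (Fin d))) :
    SimpleGraph (Set.extremePoints ℝ P) where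
  Adj u v := u ≠ v ∧ IsExtreme ℝ P (segment ℝ (u : EuclideanSpace ℝ (Fin d)) v)
  symm := ⟨fun u v h => ⟨h.1.symm, by rw [segment_symm]; exact h.2⟩⟩
  loopless := ⟨fun _ h => h.1 rfl⟩

/-- The combinatorial distance between two vertices of `P`: the least number of edges of a path
in the vertex-edge graph (`⊤` if there is none). -/
def combDist {d : ℕ} (P : Set (EuclideanSpace ℝ (Fin d))) (u v : Set.extremePoints ℝ P) : ℕ∞ :=
  (skeletonGraph P).edist u v

/-- The combinatorial diameter of `P`: the largest combinatorial distance between two vertices. -/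
def combDiam {d : ℕ} (P : Set (EuclideanSpace ℝ (Fin d))) : ℕ∞ :=
  (skeletonGraph P).ediam

/-- The vertex `v` of `P` maximizes the linear objective `c` over `P`. -/
def IsMaximizer {d : ℕ} (P : Set (EuclideanSpace ℝ (Fin d))) (c : EuclideanSpace ℝ (Fin d))
    (v : Set.extremePoints ℝ P) : Prop :=
  ∀ x ∈ P, inner ℝ c x ≤ inner ℝ c (v : EuclideanSpace ℝ (Fin d))

/-- The vertex `v` of `P` minimizes the linear objective `c` over `P`. -/
def IsMinimizer {d : ℕ} (P : Set (EuclideanSpace ℝ (Fin d))) (c : EuclideanSpace ℝ (Fin d))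
    (v : Set.extremePoints ℝ P) : Prop :=
  ∀ x ∈ P, inner ℝ c (v : EuclideanSpace ℝ (Fin d)) ≤ inner ℝ c x

/-- Every row of the combined matrix `(A, b)` has Euclidean norm at most `1`. -/
def RowNormsLeOne {n d : ℕ} (A : Fin n → Fin d → ℝ) (b : Fin n → ℝ) : Prop :=
  ∀ i, √((∑ j, A i j ^ 2) + b i ^ 2) ≤ 1

/-- `S` is an `η`-dense subset of the unit sphere. -/
def IsDenseOnSphere {d : ℕ} (η : ℝ) (S : Set (EuclideanSpace ℝ (Fin d))) : Prop :=
  S ⊆ Metric.sphere 0 1 ∧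
    ∀ x ∈ Metric.sphere (0 : EuclideanSpace ℝ (Fin d)) 1, ∃ s ∈ S, ‖x - s‖ ≤ η

/-- The joint law of `(A, b)` whose entries are independent Gaussians with standard deviation `σ`
and means the entries of `(Abar, bbar)`. -/
def smoothedLaw {n d : ℕ} (Abar : Fin n → Fin d → ℝ) (bbar : Fin n → ℝ) (σ : ℝ) :
    Measure ((Fin n → Fin d → ℝ) × (Fin n → ℝ)) :=
  (Measure.pi fun i => Measure.pi fun j => gaussianReal (Abar i j) (Real.toNNReal (σ ^ 2))).prod
    (Measure.pi fun i => gaussianReal (bbar i) (Real.toNNReal (σ ^ 2)))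

/-- The number of vertices of the orthogonal projection of `P` onto `span (c, z)`. -/
def shadowVertexCount {d : ℕ} (P : Set (EuclideanSpace ℝ (Fin d)))
    (c z : EuclideanSpace ℝ (Fin d)) : ℕ∞ :=
  (Set.extremePoints ℝ ((Submodule.span ℝ {c, z}).starProjection '' P)).encard

/-- `ν` is the law of a random direction: a rotation invariant probability distribution
on `ℝᵈ` that does not charge the origin. -/
def IsSphericallySymmetric {d : ℕ} (ν : Measure (EuclideanSpace ℝ (Fin d))) : Prop :=
  IsProbabilityMeasure ν ∧ ν {0} = 0 ∧
    ∀ U : EuclideanSpace ℝ (Fin d) ≃ₗᵢ[ℝ] EuclideanSpace ℝ (Fin d), ν.map U = ν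

/-- The semi-random shadow size `R(n, d, σ)`, with the random objective `Z` of law `ν` drawn
independently of the data `(A, b)`. -/
def semiRandomShadowSize (n d : ℕ) (σ : ℝ) (ν : Measure (EuclideanSpace ℝ (Fin d))) : ℝ≥0∞ :=
  ⨆ (Abar : Fin n → Fin d → ℝ) (bbar : Fin n → ℝ) (c : EuclideanSpace ℝ (Fin d))
    (_ : RowNormsLeOne Abar bbar) (_ : ‖c‖ = 1),
    ∫⁻ ω, (shadowVertexCount (polyhedron ω.1.1 ω.1.2) c ω.2 : ℝ≥0∞)
      ∂((smoothedLaw Abar bbar σ).prod ν)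

end

/-! The polytope is, with high probability, close to the unit ball, so its facets are small, while
its simplicity lets a path change facets only slowly. Put `T = d * (σ * √(log (4/σ)))`. A volume
bound gives a `σ`-net `s` of the sphere with at most `n` points. The means are the net scaled by
`1/√2`, with constant right-hand side `1/√2`. A Chernoff bound and a union bound show that outside
an event of probability `n^(-d)` each row of `√2 (A, b)` differs from `(s i, 1)` by at most `4T`,
the errors of the two blocks being added. Hence `P` lies between the balls of radius `1 - η` and
`1/(1 - η)` with `η = O(T)`; the net costs only `σ²/2`. Points on a common facet have a midpoint of
norm at least `1 - η`, so the parallelogram law bounds their distance by `O(√T)`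
(`norm_sub_sq_le_of_common_facet`).

Almost surely no `d + 1` hyperplanes meet, so `P` is simple: along an edge at most one tight
constraint is lost, and `d - 1` consecutive edges keep a common facet. A path of length `ℓ`
therefore moves by at most `(ℓ/(d-1) + 1) * O(√T)`. Optimal vertices for opposite objectives are at
distance at least `2(1 - η)`, which forces `ℓ` to be of order `(d-1)/√T`
(`sq_le_mul_length_sq_of_near_ball`).

For the shadow bound, the vertices maximizing `t • c + z` for some real `t` form, for generic `z`, a
connected subgraph containing a maximizer and a minimizer of `c`, and they project injectively to
vertices of the shadow (`exists_combDist_le_shadowVertexCount`). A rotation invariant law without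
mass at the origin charges no hyperplane, so `z` is generic almost surely. Integrating over an event
of probability at least `1/4` turns the constant `24` into `96`. -/

noncomputable section

/-! ### Tight constraints, vertices and edges of a polyhedron. -/

section Polyhedron

/-- The `i`-th row of a matrix, as a Euclidean vector. -/
def row {n d : ℕ} (A : Fin n → Fin d → ℝ) (i : Fin n) : EuclideanSpace ℝ (Fin d) :=
  WithLp.toLp 2 (A i)

/-- The indices of the constraints that hold with equality at `x`. -/
def tight {n d : ℕ} (A : Fin n → Fin d → ℝ) (b : Fin n → ℝ) (x : EuclideanSpace ℝ (Fin d)) :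
    Finset (Fin n) :=
  Finset.univ.filter fun i => inner ℝ (row A i) x = b i

/-- The span of the rows with index in `I`. -/
def rowSpan {n d : ℕ} (A : Fin n → Fin d → ℝ) (I : Finset (Fin n)) :
    Submodule ℝ (EuclideanSpace ℝ (Fin d)) :=
  Submodule.span ℝ (row A '' (I : Set (Fin n)))

variable {n d : ℕ} {A : Fin n → Fin d → ℝ} {b : Fin n → ℝ}

lemma inner_row (A : Fin n → Fin d → ℝ) (i : Fin n) (x : EuclideanSpace ℝ (Fin d)) :
    inner ℝ (row A i) x = ∑ j, A i j * x j := by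
  simp [row, PiLp.inner_apply, mul_comm]

lemma mem_polyhedron {x : EuclideanSpace ℝ (Fin d)} :
    x ∈ polyhedron A b ↔ ∀ i, inner ℝ (row A i) x ≤ b i := by
  simp [polyhedron, inner_row]

lemma mem_tight {x : EuclideanSpace ℝ (Fin d)} {i : Fin n} :
    i ∈ tight A b x ↔ inner ℝ (row A i) x = b i := by
  simp [tight]

lemma convex_polyhedron : Convex ℝ (polyhedron A b) := by
  intro x hx y hy s t hs ht hst
  rw [mem_polyhedron] at *
  intro i
  rw [inner_add_right, inner_smul_right, inner_smul_right]
  calc s * inner ℝ (row A i) x + t * inner ℝ (row A i) y ≤ s * b i + t * b i := by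
        gcongr
        exacts [hx i, hy i]
    _ = b i := by rw [← add_mul, hst, one_mul]

lemma isClosed_polyhedron : IsClosed (polyhedron A b) := by
  have : polyhedron A b = ⋂ i, {x | inner ℝ (row A i) x ≤ b i} := by
    ext x; simp [mem_polyhedron]
  rw [this]
  exact isClosed_iInter fun i => isClosed_le (by fun_prop) continuous_const

lemma mem_rowSpan_orthogonal {I : Finset (Fin n)} {y : EuclideanSpace ℝ (Fin d)} :
    y ∈ (rowSpan A I)ᗮ ↔ ∀ i ∈ I, inner ℝ (row A i) y = 0 := by
  rw [Submodule.mem_orthogonal]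
  constructor
  · intro h i hi
    exact h _ (Submodule.subset_span ⟨i, hi, rfl⟩)
  · intro h u hu
    induction hu using Submodule.span_induction with
    | mem x hx => obtain ⟨i, hi, rfl⟩ := hx; exact h i hi
    | zero => simp
    | add x y _ _ hx hy => rw [inner_add_left, hx, hy, add_zero]
    | smul a x _ hx => rw [inner_smul_left, hx, mul_zero]

lemma finrank_rowSpan_le (A : Fin n → Fin d → ℝ) (I : Finset (Fin n)) :
    Module.finrank ℝ (rowSpan A I) ≤ I.card := by
  classical
  have h := finrank_span_finset_le_card (R := ℝ) (I.image (row A))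
  rw [Finset.coe_image] at h
  exact h.trans Finset.card_image_le

/-- The constraints that are not tight have slack, and there are finitely many of them. This
two-sided perturbation is the source of all rank statements below. -/
lemma exists_pos_add_smul_mem {x y : EuclideanSpace ℝ (Fin d)} (hx : x ∈ polyhedron A b)
    (hy : ∀ i ∈ tight A b x, inner ℝ (row A i) y = 0) :
    ∃ ε > (0 : ℝ), x + ε • y ∈ polyhedron A b ∧ x - ε • y ∈ polyhedron A b := by
  have key : ∀ i, ∀ᶠ ε in nhdsWithin (0 : ℝ) (Set.Ioi 0),
      inner ℝ (row A i) (x + ε • y) ≤ b i ∧ inner ℝ (row A i) (x - ε • y) ≤ b i := by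
    intro i
    by_cases hi : i ∈ tight A b x
    · refine Filter.Eventually.of_forall fun ε => ?_
      rw [inner_add_right, inner_sub_right, inner_smul_right, hy i hi]
      simpa using mem_polyhedron.1 hx i
    · have hlt : inner ℝ (row A i) x < b i :=
        lt_of_le_of_ne (mem_polyhedron.1 hx i) (fun h => hi (mem_tight.2 h))
      apply Filter.Eventually.filter_mono nhdsWithin_le_nhds
      have h1 : Filter.Tendsto (fun ε : ℝ => inner ℝ (row A i) (x + ε • y)) (nhds 0)
          (nhds (inner ℝ (row A i) x)) := by
        have : Continuous fun ε : ℝ => inner ℝ (row A i) (x + ε • y) := by fun_prop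
        simpa using this.tendsto 0
      have h2 : Filter.Tendsto (fun ε : ℝ => inner ℝ (row A i) (x - ε • y)) (nhds 0)
          (nhds (inner ℝ (row A i) x)) := by
        have : Continuous fun ε : ℝ => inner ℝ (row A i) (x - ε • y) := by fun_prop
        simpa using this.tendsto 0
      filter_upwards [h1.eventually_lt_const hlt, h2.eventually_lt_const hlt] with ε h3 h4
      exact ⟨h3.le, h4.le⟩
  obtain ⟨ε, hε, hpos⟩ := ((Filter.eventually_all.2 key).and self_mem_nhdsWithin).exists
  exact ⟨ε, hpos, mem_polyhedron.2 fun i => (hε i).1, mem_polyhedron.2 fun i => (hε i).2⟩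

lemma tight_openSegment {x p q : EuclideanSpace ℝ (Fin d)} (hp : p ∈ polyhedron A b)
    (hq : q ∈ polyhedron A b) (hx : x ∈ openSegment ℝ p q) :
    tight A b x = tight A b p ∩ tight A b q := by
  obtain ⟨s, t, hs, ht, hst, rfl⟩ := hx
  ext i
  rw [Finset.mem_inter, mem_tight, mem_tight, mem_tight, inner_add_right, inner_smul_right,
    inner_smul_right]
  have h1 := mem_polyhedron.1 hp i
  have h2 := mem_polyhedron.1 hq i
  obtain rfl : t = 1 - s := by linarith
  constructor
  · intro h
    constructor <;> nlinarith
  · rintro ⟨h3, h4⟩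
    rw [h3, h4]; ring

lemma eq_zero_of_mem_extremePoints {x y : EuclideanSpace ℝ (Fin d)}
    (hx : x ∈ Set.extremePoints ℝ (polyhedron A b))
    (hy : ∀ i ∈ tight A b x, inner ℝ (row A i) y = 0) : y = 0 := by
  obtain ⟨ε, hε, h1, h2⟩ := exists_pos_add_smul_mem hx.1 hy
  have h3 := hx.2 h1 h2 (mem_openSegment_add_sub (𝕜 := ℝ) x (ε • y))
  have h4 : ε • y = 0 := by simpa using h3
  exact (smul_eq_zero.1 h4).resolve_left hε.ne'

lemma le_card_tight {x : EuclideanSpace ℝ (Fin d)}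
    (hx : x ∈ Set.extremePoints ℝ (polyhedron A b)) : d ≤ (tight A b x).card := by
  have h : (rowSpan A (tight A b x))ᗮ = ⊥ := by
    rw [Submodule.eq_bot_iff]
    intro y hy
    exact eq_zero_of_mem_extremePoints hx (mem_rowSpan_orthogonal.1 hy)
  have h2 := Submodule.finrank_add_finrank_orthogonal (rowSpan A (tight A b x))
  rw [h] at h2
  rw [finrank_bot, add_zero, finrank_euclideanSpace_fin] at h2
  exact h2.symm.le.trans (finrank_rowSpan_le A _)

lemma eq_of_tight_subset {x x' : EuclideanSpace ℝ (Fin d)}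
    (hx : x ∈ Set.extremePoints ℝ (polyhedron A b)) (h : tight A b x ⊆ tight A b x') :
    x = x' := by
  refine sub_eq_zero.1 (eq_zero_of_mem_extremePoints hx fun i hi => ?_)
  rw [inner_sub_right, mem_tight.1 hi, mem_tight.1 (h hi), sub_self]

lemma finite_extremePoints_polyhedron (A : Fin n → Fin d → ℝ) (b : Fin n → ℝ) :
    (Set.extremePoints ℝ (polyhedron A b)).Finite :=
  Set.Finite.of_injOn (f := tight A b) (t := Set.univ) (fun _ _ => Set.mem_univ _)
    (fun _ hx _ _ h => eq_of_tight_subset hx h.subset) Set.finite_univ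

lemma openSegment_midpoint_mem (u v : EuclideanSpace ℝ (Fin d)) :
    (1 / 2 : ℝ) • (u + v) ∈ openSegment ℝ u v :=
  ⟨1 / 2, 1 / 2, by norm_num, by norm_num, by norm_num, by module⟩

/-- The common tight constraints are those of the midpoint. A direction orthogonal to them can be
followed both ways inside `P`, so by extremality it stays on the edge. The rows thus have rank at
least `d - 1`. -/
lemma le_card_tight_inter_of_adj {u v : Set.extremePoints ℝ (polyhedron A b)}
    (h : (skeletonGraph (polyhedron A b)).Adj u v) :
    d ≤ (tight A b u ∩ tight A b v).card + 1 := by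
  obtain ⟨u, hu⟩ := u
  obtain ⟨v, hv⟩ := v
  obtain ⟨hne, hext⟩ := h
  simp only at hext ⊢
  set m : EuclideanSpace ℝ (Fin d) := (1 / 2 : ℝ) • (u + v) with hm
  have hms := openSegment_midpoint_mem u v
  have hmt := tight_openSegment hu.1 hv.1 hms
  have hmP : m ∈ polyhedron A b := convex_polyhedron.openSegment_subset hu.1 hv.1 hms
  rw [← hmt, ← hm]
  have hle : (rowSpan A (tight A b m))ᗮ ≤ Submodule.span ℝ {v - u} := by
    intro y hy
    obtain ⟨ε, hε, h1, h2⟩ := exists_pos_add_smul_mem hmP (mem_rowSpan_orthogonal.1 hy)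
    have h3 := hext.2 h1 h2 (openSegment_subset_segment ℝ u v hms) (mem_openSegment_add_sub (𝕜 := ℝ) m _)
    rw [segment_eq_image'] at h3
    obtain ⟨t, -, ht⟩ := h3
    simp only at ht
    rw [Submodule.mem_span_singleton]
    refine ⟨ε⁻¹ * (t - 1 / 2), ?_⟩
    have h4 : ε • y = (t - 1 / 2) • (v - u) := by
      have : ε • y = (u + t • (v - u)) - m := by rw [ht]; abel
      rw [this, hm]; module
    rw [mul_smul, ← h4, smul_smul, inv_mul_cancel₀ hε.ne', one_smul]
  have h2 := Submodule.finrank_add_finrank_orthogonal (rowSpan A (tight A b m))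
  have h3 := Submodule.finrank_mono hle
  have h4 := finrank_span_le_card (R := ℝ) ({v - u} : Set (EuclideanSpace ℝ (Fin d)))
  rw [Set.toFinset_singleton, Finset.card_singleton] at h4
  have h5 := finrank_rowSpan_le A (tight A b m)
  rw [finrank_euclideanSpace_fin] at h2
  omega

/-- If a segment of `P` meets `[u, v]` in its interior, its endpoints share the tight constraints of
`u` and `v`, hence lie on the line through them. An endpoint beyond `u` or `v` would put that vertex
inside a segment of `P`. -/
lemma adj_of_orthogonal_le {u v : Set.extremePoints ℝ (polyhedron A b)} (hne : u ≠ v)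
    (h : (rowSpan A (tight A b u ∩ tight A b v))ᗮ ≤
      Submodule.span ℝ {(v : EuclideanSpace ℝ (Fin d)) - u}) :
    (skeletonGraph (polyhedron A b)).Adj u v := by
  obtain ⟨u, hu⟩ := u
  obtain ⟨v, hv⟩ := v
  have hne' : u ≠ v := fun h => hne (Subtype.ext h)
  simp only at h
  refine ⟨hne, convex_polyhedron.segment_subset hu.1 hv.1, ?_⟩
  simp only
  intro p hp q hq x hx hxpq
  have hxP := convex_polyhedron.segment_subset hu.1 hv.1 hx
  have hxt : tight A b u ∩ tight A b v ⊆ tight A b x := by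
    intro i hi
    rw [Finset.mem_inter, mem_tight, mem_tight] at hi
    obtain ⟨s, t, hs, ht, hst, rfl⟩ := hx
    rw [mem_tight, inner_add_right, inner_smul_right, inner_smul_right, hi.1, hi.2, ← add_mul,
      hst, one_mul]
  have hpt : tight A b u ∩ tight A b v ⊆ tight A b p :=
    hxt.trans ((tight_openSegment hp hq hxpq).subset.trans Finset.inter_subset_left)
  have hmem : p - u ∈ Submodule.span ℝ {v - u} := by
    refine h (mem_rowSpan_orthogonal.2 fun i hi => ?_)
    rw [inner_sub_right, mem_tight.1 (hpt hi), mem_tight.1 (Finset.mem_inter.1 hi).1, sub_self]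
  obtain ⟨t, ht⟩ := Submodule.mem_span_singleton.1 hmem
  have hp' : p = u + t • (v - u) := by rw [ht]; abel
  rw [segment_eq_image']
  refine ⟨t, ⟨?_, ?_⟩, hp'.symm⟩
  · by_contra! hneg
    have := hu.2 hp hv.1 ⟨1 / (1 - t), -t / (1 - t), by
      apply div_pos <;> linarith, by apply div_pos <;> linarith, by
      have : 1 - t ≠ 0 := by linarith
      field_simp; ring, by
      have h0 : 1 - t ≠ 0 := by linarith
      rw [hp']
      match_scalars <;> field_simp <;> ring⟩
    have h6 : t • (v - u) = 0 := by
      have h7 := hp'.symm.trans this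
      simpa using h7
    rcases smul_eq_zero.1 h6 with h8 | h8
    · linarith
    · exact hne' (sub_eq_zero.1 h8).symm
  · by_contra! hgt
    have := hv.2 hp hu.1 ⟨1 / t, (t - 1) / t, by
      apply div_pos <;> linarith, by apply div_pos <;> linarith, by
      have : t ≠ 0 := by linarith
      field_simp; ring, by
      have h0 : t ≠ 0 := by linarith
      rw [hp']
      match_scalars <;> field_simp
      ring⟩
    have h6 : (t - 1) • (v - u) = 0 := by
      have h7 := hp'.symm.trans this
      rw [sub_smul, one_smul, sub_eq_zero, eq_sub_iff_add_eq, add_comm]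
      exact h7
    rcases smul_eq_zero.1 h6 with h8 | h8
    · linarith
    · exact hne' (sub_eq_zero.1 h8).symm

end Polyhedron

/-! ### Length of paths in a simple polytope close to the ball. -/

section Diameter

variable {n d : ℕ} {A : Fin n → Fin d → ℝ} {b : Fin n → ℝ}

section NearBall
variable {s : Fin n → EuclideanSpace ℝ (Fin d)} {σ τ η : ℝ}

lemma mem_polyhedron_of_norm_le (hs : ∀ i, ‖s i‖ = 1)
    (h : ∀ i, ‖√2 • row A i - s i‖ + |√2 * b i - 1| ≤ τ) (hτ : τ ≤ η) (hη : 0 ≤ η)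
    {x : EuclideanSpace ℝ (Fin d)} (hx : ‖x‖ ≤ 1 - η) : x ∈ polyhedron A b := by
  rw [mem_polyhedron]
  intro i
  have h2 : (0 : ℝ) < √2 := by positivity
  have h1 : inner ℝ (√2 • row A i) x ≤ ‖√2 • row A i‖ * ‖x‖ := real_inner_le_norm _ _
  have h3 : ‖√2 • row A i‖ ≤ 1 + ‖√2 • row A i - s i‖ := by
    have := norm_add_le (s i) (√2 • row A i - s i)
    rwa [add_sub_cancel, hs i] at this
  have h4 := neg_abs_le (√2 * b i - 1)
  have h5 := h i
  have h6 : inner ℝ (√2 • row A i) x = √2 * inner ℝ (row A i) x := by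
    rw [inner_smul_left]; simp
  rw [h6] at h1
  have h7 := norm_nonneg x
  have h8 := norm_nonneg (√2 • row A i - s i)
  have h9 : ‖√2 • row A i‖ * ‖x‖ ≤ (1 + ‖√2 • row A i - s i‖) * (1 - η) := by gcongr
  have h10 : √2 * inner ℝ (row A i) x ≤ √2 * b i := by nlinarith
  exact le_of_mul_le_mul_left h10 h2

lemma norm_mul_le_of_mem_polyhedron (hs : IsDenseOnSphere σ (Set.range s))
    (h : ∀ i, ‖√2 • row A i - s i‖ + |√2 * b i - 1| ≤ τ) (hτ : τ + σ ^ 2 / 2 ≤ η)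
    {x : EuclideanSpace ℝ (Fin d)} (hx : x ∈ polyhedron A b) : ‖x‖ * (1 - η) ≤ 1 := by
  rcases eq_or_ne x 0 with rfl | hx0
  · simp
  have hxn : 0 < ‖x‖ := norm_pos_iff.2 hx0
  have hu : ‖‖x‖⁻¹ • x‖ = 1 := by
    rw [norm_smul, norm_inv, norm_norm, inv_mul_cancel₀ hxn.ne']
  obtain ⟨_, ⟨i, rfl⟩, hi⟩ := hs.2 (‖x‖⁻¹ • x) (by simpa using hu)
  have hsi : ‖s i‖ = 1 := by simpa using hs.1 ⟨i, rfl⟩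
  have h2 : (0 : ℝ) < √2 := by positivity
  have h1 : ‖‖x‖⁻¹ • x - s i‖ ^ 2 ≤ σ ^ 2 := by gcongr
  rw [norm_sub_sq_real, hu, hsi, inner_smul_left] at h1
  -- For unit vectors, distance at most `σ` means inner product at least `1 - σ²/2`, so the net
  -- error is of second order.
  have h3 : ‖x‖ * (1 - σ ^ 2 / 2) ≤ inner ℝ (s i) x := by
    rw [real_inner_comm]
    have : 1 - σ ^ 2 / 2 ≤ ‖x‖⁻¹ * inner ℝ x (s i) := by simp at h1; linarith
    calc ‖x‖ * (1 - σ ^ 2 / 2) ≤ ‖x‖ * (‖x‖⁻¹ * inner ℝ x (s i)) := by gcongr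
      _ = inner ℝ x (s i) := by field_simp
  have h4 : √2 * inner ℝ (row A i) x ≤ √2 * b i := by
    gcongr
    exact mem_polyhedron.1 hx i
  have h6 : inner ℝ (√2 • row A i) x = √2 * inner ℝ (row A i) x := by
    rw [inner_smul_left]; simp
  have h7 : inner ℝ (s i) x - ‖√2 • row A i - s i‖ * ‖x‖ ≤ inner ℝ (√2 • row A i) x := by
    have := (abs_le.1 (abs_real_inner_le_norm (√2 • row A i - s i) x)).1
    rw [inner_sub_left] at this
    linarith
  have h8 := le_abs_self (√2 * b i - 1)
  have h5 := h i
  have h9 := norm_nonneg (√2 • row A i - s i)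
  have h10 := abs_nonneg (√2 * b i - 1)
  set e := ‖√2 • row A i - s i‖
  set f := |√2 * b i - 1|
  have h11 : ‖x‖ * (1 - σ ^ 2 / 2 - e) ≤ 1 + f := by linarith
  have h12 : 0 ≤ σ ^ 2 / 2 := by positivity
  by_cases hη : η < 1
  · have h13 : (1 + f) * (1 - η) ≤ 1 - σ ^ 2 / 2 - e := by nlinarith
    have h14 : 0 < 1 - σ ^ 2 / 2 - e := by linarith
    have : ‖x‖ * (1 - σ ^ 2 / 2 - e) * (1 - η) ≤ (1 - σ ^ 2 / 2 - e) :=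
      (mul_le_mul_of_nonneg_right h11 (by linarith)).trans h13
    have h15 : ‖x‖ * (1 - η) * (1 - σ ^ 2 / 2 - e) ≤ 1 * (1 - σ ^ 2 / 2 - e) := by linarith
    exact le_of_mul_le_mul_right h15 h14
  · nlinarith

lemma one_sub_le_norm_of_tight (hs : ∀ i, ‖s i‖ = 1)
    (h : ∀ i, ‖√2 • row A i - s i‖ + |√2 * b i - 1| ≤ τ) (hτ : τ ≤ η)
    {x : EuclideanSpace ℝ (Fin d)} {i : Fin n} (hx : inner ℝ (row A i) x = b i) :
    1 - η ≤ ‖x‖ := by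
  have h1 : inner ℝ (√2 • row A i) x ≤ ‖√2 • row A i‖ * ‖x‖ := real_inner_le_norm _ _
  have h3 : ‖√2 • row A i‖ ≤ 1 + ‖√2 • row A i - s i‖ := by
    have := norm_add_le (s i) (√2 • row A i - s i)
    rwa [add_sub_cancel, hs i] at this
  have h4 := neg_abs_le (√2 * b i - 1)
  have h5 := h i
  have h6 : inner ℝ (√2 • row A i) x = √2 * b i := by
    rw [inner_smul_left, hx]; simp
  rw [h6] at h1
  have h7 := norm_nonneg x
  have h8 := norm_nonneg (√2 • row A i - s i)
  have h10 := abs_nonneg (√2 * b i - 1)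
  have h9 : ‖√2 • row A i‖ * ‖x‖ ≤ (1 + ‖√2 • row A i - s i‖) * ‖x‖ := by gcongr
  by_contra! hlt
  nlinarith

lemma norm_sub_sq_le_of_common_facet (hs : IsDenseOnSphere σ (Set.range s))
    (h : ∀ i, ‖√2 • row A i - s i‖ + |√2 * b i - 1| ≤ τ) (hτ : τ + σ ^ 2 / 2 ≤ η) (hη : η < 1)
    {x y : EuclideanSpace ℝ (Fin d)} (hx : x ∈ polyhedron A b) (hy : y ∈ polyhedron A b)
    {i : Fin n} (hi : i ∈ tight A b x ∩ tight A b y) :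
    ‖x - y‖ ^ 2 ≤ 4 * ((1 / (1 - η)) ^ 2 - (1 - η) ^ 2) := by
  have hs1 : ∀ i, ‖s i‖ = 1 := fun i => by simpa using hs.1 ⟨i, rfl⟩
  have hms := openSegment_midpoint_mem x y
  rw [← tight_openSegment hx hy hms, mem_tight] at hi
  have h1 := one_sub_le_norm_of_tight (η := η) hs1 h (by linarith [sq_nonneg σ]) hi
  have h2 : 0 < 1 - η := by linarith
  have h3 := (le_div_iff₀ h2).2 (norm_mul_le_of_mem_polyhedron hs h hτ hx)
  have h4 := (le_div_iff₀ h2).2 (norm_mul_le_of_mem_polyhedron hs h hτ hy)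
  have h5 := parallelogram_law_with_norm ℝ x y
  rw [norm_smul] at h1
  have h6 : (1 - η) * 2 ≤ ‖x + y‖ := by norm_num at h1; linarith
  have h7 : ‖x‖ ^ 2 ≤ (1 / (1 - η)) ^ 2 := by gcongr
  have h8 : ‖y‖ ^ 2 ≤ (1 / (1 - η)) ^ 2 := by gcongr
  have h9 : ((1 - η) * 2) ^ 2 ≤ ‖x + y‖ ^ 2 := by gcongr
  nlinarith

end NearBall

section Simple

/-- By simplicity, the set kept along the rest of the walk and the constraints common to the first
edge both lie in the at most `d` tight constraints of `v`. Inclusion-exclusion then shows that each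
edge costs at most one element. -/
lemma exists_subset_tight_inter_of_walk
    (hsimple : ∀ x ∈ polyhedron A b, (tight A b x).card ≤ d)
    {u v : Set.extremePoints ℝ (polyhedron A b)} (p : (skeletonGraph (polyhedron A b)).Walk u v) :
    ∃ I ⊆ tight A b u ∩ tight A b v, d ≤ I.card + p.length := by
  induction p with
  | @nil u => exact ⟨tight A b u, by simp, by simpa using le_card_tight u.2⟩
  | @cons u v w h p ih =>
    obtain ⟨I, hI, hId⟩ := ih
    have hJ := le_card_tight_inter_of_adj h
    refine ⟨I ∩ (tight A b u ∩ tight A b v), ?_, ?_⟩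
    · intro i hi
      rw [Finset.mem_inter] at hi ⊢
      exact ⟨(Finset.mem_inter.1 hi.2).1, (Finset.mem_inter.1 (hI hi.1)).2⟩
    · have h1 := Finset.card_union_add_card_inter I (tight A b u ∩ tight A b v)
      have h2 : (I ∪ (tight A b u ∩ tight A b v)).card ≤ d := by
        refine (Finset.card_le_card ?_).trans (hsimple v v.2.1)
        exact Finset.union_subset (hI.trans Finset.inter_subset_left) Finset.inter_subset_right
      rw [SimpleGraph.Walk.length_cons]
      omega

/-- The walk is cut into blocks of `d - 1` edges: the ends of each block still share at least one
facet. -/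
lemma norm_sub_le_of_walk (hsimple : ∀ x ∈ polyhedron A b, (tight A b x).card ≤ d) (hd : 2 ≤ d)
    {D : ℝ} (hD : ∀ x ∈ polyhedron A b, ∀ y ∈ polyhedron A b,
      (tight A b x ∩ tight A b y).Nonempty → ‖x - y‖ ≤ D)
    (m : ℕ) {u v : Set.extremePoints ℝ (polyhedron A b)}
    (p : (skeletonGraph (polyhedron A b)).Walk u v) (hp : p.length ≤ m * (d - 1)) :
    ‖(u : EuclideanSpace ℝ (Fin d)) - v‖ ≤ m * D := by
  induction m generalizing u v with
  | zero =>
    have : u = v := SimpleGraph.Walk.eq_of_length_eq_zero (p := p) (by omega)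
    simp [this]
  | succ m ih =>
    have h1 := ih (p.drop (d - 1)) (by
      rw [SimpleGraph.Walk.drop_length]
      rw [add_mul] at hp
      omega)
    obtain ⟨I, hI, hId⟩ := exists_subset_tight_inter_of_walk hsimple (p.take (d - 1))
    have h2 : (p.take (d - 1)).length ≤ d - 1 := by
      rw [SimpleGraph.Walk.take_length]; exact min_le_left _ _
    have h3 : I.Nonempty := by
      rw [← Finset.card_pos]; omega
    have h4 := hD _ u.2.1 _ (p.getVert (d - 1)).2.1 (h3.mono hI)
    have h5 := norm_sub_le_norm_sub_add_norm_sub (u : EuclideanSpace ℝ (Fin d))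
      (p.getVert (d - 1)) v
    push_cast
    linarith

/-- The optimal face is compact, so it has an extreme point, which is also extreme in `P`. -/
lemma exists_isMaximizer {P : Set (EuclideanSpace ℝ (Fin d))} (hP : IsCompact P)
    (hne : P.Nonempty) (c : EuclideanSpace ℝ (Fin d)) : ∃ v, IsMaximizer P c v := by
  have hexp : IsExposed ℝ P ((innerSL ℝ c).toExposed P) :=
    ContinuousLinearMap.toExposed.isExposed
  obtain ⟨x, hx, hmax⟩ := hP.exists_isMaxOn hne (f := fun x => inner ℝ c x) (by fun_prop)
  have hxF : x ∈ (innerSL ℝ c).toExposed P := ⟨hx, fun y hy => hmax hy⟩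
  obtain ⟨v, hv⟩ := (hexp.isCompact hP).extremePoints_nonempty ⟨x, hxF⟩
  refine ⟨⟨v, hexp.isExtreme.extremePoints_subset_extremePoints hv⟩, fun y hy => ?_⟩
  exact hv.1.2 y hy

lemma isMaximizer_neg {P : Set (EuclideanSpace ℝ (Fin d))} {c : EuclideanSpace ℝ (Fin d)}
    {v : Set.extremePoints ℝ P} : IsMaximizer P (-c) v ↔ IsMinimizer P c v := by
  simp [IsMaximizer, IsMinimizer]

lemma exists_isMinimizer {P : Set (EuclideanSpace ℝ (Fin d))} (hP : IsCompact P)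
    (hne : P.Nonempty) (c : EuclideanSpace ℝ (Fin d)) : ∃ v, IsMinimizer P c v := by
  simpa only [isMaximizer_neg] using exists_isMaximizer hP hne (-c)

lemma isCompact_polyhedron_of_near_ball {s : Fin n → EuclideanSpace ℝ (Fin d)} {σ τ η : ℝ}
    (hs : IsDenseOnSphere σ (Set.range s))
    (h : ∀ i, ‖√2 • row A i - s i‖ + |√2 * b i - 1| ≤ τ) (hτ : τ + σ ^ 2 / 2 ≤ η) (hη : η < 1) :
    IsCompact (polyhedron A b) := by
  refine Metric.isCompact_of_isClosed_isBounded isClosed_polyhedron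
    ((Metric.isBounded_closedBall (x := 0) (r := 1 / (1 - η))).subset fun x hx => ?_)
  rw [mem_closedBall_zero_iff, le_div_iff₀ (by linarith)]
  exact norm_mul_le_of_mem_polyhedron hs h hτ hx

lemma two_mul_le_norm_sub_of_isMaximizer_of_isMinimizer {P : Set (EuclideanSpace ℝ (Fin d))}
    {r : ℝ} (hr : 0 ≤ r) (hP : ∀ x, ‖x‖ ≤ r → x ∈ P) {c : EuclideanSpace ℝ (Fin d)} (hc : c ≠ 0)
    {v w : Set.extremePoints ℝ P} (hv : IsMaximizer P c v) (hw : IsMinimizer P c w) :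
    2 * r ≤ ‖(v : EuclideanSpace ℝ (Fin d)) - w‖ := by
  have hcn : 0 < ‖c‖ := norm_pos_iff.2 hc
  have hnorm : ‖(r / ‖c‖) • c‖ = r := by
    rw [norm_smul, norm_div, norm_norm, Real.norm_of_nonneg hr]; field_simp
  have h1 := hv _ (hP ((r / ‖c‖) • c) hnorm.le)
  have h2 := hw _ (hP (-((r / ‖c‖) • c)) (by rw [norm_neg]; exact hnorm.le))
  have h0 : inner ℝ c ((r / ‖c‖) • c) = r * ‖c‖ := by
    rw [inner_smul_right, real_inner_self_eq_norm_sq]; field_simp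
  rw [inner_neg_right] at h2
  rw [h0] at h1 h2
  have h3 := real_inner_le_norm c ((v : EuclideanSpace ℝ (Fin d)) - w)
  rw [inner_sub_right] at h3
  have h4 : 2 * r * ‖c‖ ≤ ‖(v : EuclideanSpace ℝ (Fin d)) - w‖ * ‖c‖ := by linarith
  exact le_of_mul_le_mul_right h4 hcn

/-- In a simple polytope that is close to the unit ball, a path between opposite vertices
is long. -/
theorem sq_le_mul_length_sq_of_near_ball {s : Fin n → EuclideanSpace ℝ (Fin d)} {σ T : ℝ}
    (hd : 2 ≤ d) (hs : IsDenseOnSphere σ (Set.range s))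
    (h : ∀ i, ‖√2 • row A i - s i‖ + |√2 * b i - 1| ≤ 4 * T) (hσT : σ ^ 2 ≤ T) (hT : T ≤ 1 / 32)
    (hsimple : ∀ x ∈ polyhedron A b, (tight A b x).card ≤ d)
    {c : EuclideanSpace ℝ (Fin d)} (hc : c ≠ 0) {v w : Set.extremePoints ℝ (polyhedron A b)}
    (hv : IsMaximizer (polyhedron A b) c v) (hw : IsMinimizer (polyhedron A b) c w)
    (p : (skeletonGraph (polyhedron A b)).Walk v w) :
    ((d : ℝ) - 1) ^ 2 ≤ 144 * T * (p.length : ℝ) ^ 2 := by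
  have hT0 : 0 ≤ T := (sq_nonneg σ).trans hσT
  -- `4 * T` for the perturbation plus `T / 2` for the net, since `σ ^ 2 ≤ T`.
  obtain ⟨η, hη⟩ : ∃ η, η = 9 / 2 * T := ⟨_, rfl⟩
  have hτ : 4 * T + σ ^ 2 / 2 ≤ η := by linarith
  have hs1 : ∀ i, ‖s i‖ = 1 := fun i => by simpa using hs.1 ⟨i, rfl⟩
  have h1 := two_mul_le_norm_sub_of_isMaximizer_of_isMinimizer (r := 1 - η) (by linarith)
    (fun x hx => mem_polyhedron_of_norm_le hs1 h (by linarith) (by linarith) hx) hc hv hw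
  obtain ⟨m, hm⟩ : ∃ m : ℕ, m = p.length / (d - 1) + 1 := ⟨_, rfl⟩
  have hpm : p.length ≤ m * (d - 1) := by
    rw [hm, add_mul, one_mul]
    exact (Nat.lt_div_mul_add (by omega)).le
  have h2 := norm_sub_le_of_walk hsimple hd
    (D := √(4 * ((1 / (1 - η)) ^ 2 - (1 - η) ^ 2))) (fun x hx y hy ⟨i, hi⟩ =>
      Real.le_sqrt_of_sq_le (norm_sub_sq_le_of_common_facet hs h hτ (by linarith) hx hy hi)) m p hpm
  obtain ⟨r, hr⟩ : ∃ r, r = 1 - η := ⟨_, rfl⟩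
  rw [← hr] at h1 h2
  have hr0 : 55 / 64 ≤ r := by linarith
  have hr1 : r ≤ 1 := by linarith
  have hR : 0 ≤ 4 * ((1 / r) ^ 2 - r ^ 2) := by
    have h3 : 1 ≤ 1 / r := by rw [le_div_iff₀ (by linarith)]; linarith
    nlinarith
  have h3 : (2 * r) ^ 2 ≤ (m * √(4 * ((1 / r) ^ 2 - r ^ 2))) ^ 2 := by
    exact pow_le_pow_left₀ (by linarith) (h1.trans h2) 2
  rw [mul_pow (m : ℝ), Real.sq_sqrt hR] at h3
  have h4 : r ^ 4 ≤ m ^ 2 * (1 - r ^ 4) := by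
    have h5 : (m : ℝ) ^ 2 * (1 - r ^ 4) = r ^ 2 / 4 * (m ^ 2 * (4 * ((1 / r) ^ 2 - r ^ 2))) := by
      field_simp
    rw [h5]
    calc r ^ 4 = r ^ 2 / 4 * (2 * r) ^ 2 := by ring
      _ ≤ _ := by gcongr
  have h6 : 1 / 2 < r ^ 4 := by
    calc (1 / 2 : ℝ) < (55 / 64) ^ 4 := by norm_num
      _ ≤ r ^ 4 := by gcongr
  -- A single block would give `r ^ 4 ≤ 1 / 2`. With `2 ≤ m` the rounding in `m` costs only a factor
  -- two, `m ≤ 2 * (m - 1)`.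
  have hm2 : 2 ≤ m := by
    by_contra! hlt
    have h1m : 1 ≤ m := hm ▸ Nat.le_add_left _ _
    have : m = 1 := le_antisymm (Nat.le_of_lt_succ hlt) h1m
    rw [this] at h4
    norm_num at h4
    linarith
  -- Bernoulli's inequality.
  have h7 : 1 - r ^ 4 ≤ 4 * η := by
    have := one_add_mul_le_pow (a := -η) (by linarith) 4
    rw [show 1 + -η = r by rw [hr]; ring] at this
    push_cast at this
    linarith
  have h8 : 1 ≤ m ^ 2 * (36 * T) := by
    have : (m : ℝ) ^ 2 * (1 - r ^ 4) ≤ m ^ 2 * (4 * η) := by gcongr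
    rw [hη] at this
    linarith
  have h9 : m * (d - 1) ≤ 2 * p.length := by
    have h10 := Nat.div_mul_le_self p.length (d - 1)
    have h11 : m * (d - 1) ≤ 2 * (m - 1) * (d - 1) := Nat.mul_le_mul_right _ (by omega)
    have h12 : m - 1 = p.length / (d - 1) := by rw [hm, Nat.add_sub_cancel]
    rw [← h12] at h10
    rw [mul_assoc] at h11
    exact h11.trans (Nat.mul_le_mul_left 2 h10)
  have h13 : (m : ℝ) * ((d : ℝ) - 1) ≤ 2 * p.length := by
    have : ((m * (d - 1) : ℕ) : ℝ) ≤ ((2 * p.length : ℕ) : ℝ) := by exact_mod_cast h9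
    push_cast [Nat.cast_sub (show 1 ≤ d by omega)] at this
    exact this
  have hd1 : (0 : ℝ) ≤ (d : ℝ) - 1 := by
    have : (2 : ℝ) ≤ d := by exact_mod_cast hd
    linarith
  have h14 : (m * ((d : ℝ) - 1)) ^ 2 ≤ (2 * p.length) ^ 2 := by gcongr
  calc ((d : ℝ) - 1) ^ 2 ≤ (m ^ 2 * (36 * T)) * ((d : ℝ) - 1) ^ 2 :=
        le_mul_of_one_le_left (sq_nonneg _) h8
    _ = 36 * T * (m * ((d : ℝ) - 1)) ^ 2 := by ring
    _ ≤ 36 * T * (2 * p.length) ^ 2 := by gcongr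
    _ = _ := by ring

end Simple

end Diameter

/-! ### The shadow path of a generic plane. -/

section Shadow

variable {n d : ℕ} {A : Fin n → Fin d → ℝ} {b : Fin n → ℝ}

/-- The direction `z` lies in no proper subspace spanned by `c` and rows of `A`. -/
def IsGenericDirection (A : Fin n → Fin d → ℝ) (c z : EuclideanSpace ℝ (Fin d)) : Prop :=
  ∀ I : Finset (Fin n), rowSpan A I ⊔ Submodule.span ℝ {c} ≠ ⊤ →
    z ∉ rowSpan A I ⊔ Submodule.span ℝ {c}

variable {c z : EuclideanSpace ℝ (Fin d)}

lemma mem_rowSpan_tight_of_forall_inner_le {w x : EuclideanSpace ℝ (Fin d)}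
    (hx : x ∈ polyhedron A b) (hmax : ∀ y ∈ polyhedron A b, inner ℝ w y ≤ inner ℝ w x) :
    w ∈ rowSpan A (tight A b x) := by
  rw [← Submodule.orthogonal_orthogonal (rowSpan A (tight A b x)), Submodule.mem_orthogonal']
  intro y hy
  obtain ⟨ε, hε, h1, h2⟩ := exists_pos_add_smul_mem hx (mem_rowSpan_orthogonal.1 hy)
  have h3 := hmax _ h1
  have h4 := hmax _ h2
  rw [inner_add_right, inner_smul_right] at h3
  rw [inner_sub_right, inner_smul_right] at h4
  have : ε * inner ℝ w y = 0 := by linarith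
  exact (mul_eq_zero.1 this).resolve_left hε.ne'

lemma rowSpan_tight_sup_eq_top (hz : IsGenericDirection A c z) {t : ℝ}
    {x : EuclideanSpace ℝ (Fin d)} (hx : x ∈ polyhedron A b)
    (hmax : ∀ y ∈ polyhedron A b, inner ℝ (t • c + z) y ≤ inner ℝ (t • c + z) x) :
    rowSpan A (tight A b x) ⊔ Submodule.span ℝ {c} = ⊤ := by
  by_contra hne
  apply hz _ hne
  have h1 : t • c + z ∈ rowSpan A (tight A b x) ⊔ Submodule.span ℝ {c} :=
    Submodule.mem_sup_left (mem_rowSpan_tight_of_forall_inner_le hx hmax)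
  have h2 : t • c ∈ rowSpan A (tight A b x) ⊔ Submodule.span ℝ {c} :=
    Submodule.mem_sup_right (Submodule.smul_mem _ _ (Submodule.mem_span_singleton_self c))
  simpa using Submodule.sub_mem _ h1 h2

/-- The midpoint of two maximizers is a maximizer whose tight set is the intersection. So the
optimal face of `t • c + z` is at most an edge, along which `c` is not constant. -/
lemma rowSpan_tight_inter_sup_eq_top (hz : IsGenericDirection A c z) {t : ℝ}
    {p q : EuclideanSpace ℝ (Fin d)} (hp : p ∈ polyhedron A b) (hq : q ∈ polyhedron A b)
    (hpmax : ∀ y ∈ polyhedron A b, inner ℝ (t • c + z) y ≤ inner ℝ (t • c + z) p)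
    (hqmax : ∀ y ∈ polyhedron A b, inner ℝ (t • c + z) y ≤ inner ℝ (t • c + z) q) :
    rowSpan A (tight A b p ∩ tight A b q) ⊔ Submodule.span ℝ {c} = ⊤ := by
  have hms := openSegment_midpoint_mem p q
  rw [← tight_openSegment hp hq hms]
  refine rowSpan_tight_sup_eq_top hz (convex_polyhedron.openSegment_subset hp hq hms)
    (t := t) fun y hy => ?_
  have h1 := hpmax y hy
  have h2 := hqmax y hy
  rw [inner_smul_right, inner_add_right]
  linarith

lemma sub_mem_rowSpan_tight_inter_orthogonal (p q : EuclideanSpace ℝ (Fin d)) :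
    p - q ∈ (rowSpan A (tight A b p ∩ tight A b q))ᗮ := by
  refine mem_rowSpan_orthogonal.2 fun i hi => ?_
  rw [Finset.mem_inter, mem_tight, mem_tight] at hi
  rw [inner_sub_right, hi.1, hi.2, sub_self]

lemma adj_of_isMaximizer (hz : IsGenericDirection A c z) {t : ℝ}
    {u v : Set.extremePoints ℝ (polyhedron A b)} (huv : u ≠ v)
    (hu : IsMaximizer (polyhedron A b) (t • c + z) u)
    (hv : IsMaximizer (polyhedron A b) (t • c + z) v) :
    (skeletonGraph (polyhedron A b)).Adj u v := by
  refine adj_of_orthogonal_le huv ?_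
  have h1 := rowSpan_tight_inter_sup_eq_top hz u.2.1 v.2.1 hu hv
  set K := rowSpan A (tight A b u ∩ tight A b v) with hK
  have hne : (v : EuclideanSpace ℝ (Fin d)) - u ≠ 0 := by
    rw [sub_ne_zero]; exact fun h => huv (Subtype.ext h.symm)
  have hmem : (v : EuclideanSpace ℝ (Fin d)) - u ∈ Kᗮ := by
    rw [hK, Finset.inter_comm]
    exact sub_mem_rowSpan_tight_inter_orthogonal _ _
  have h2 := Submodule.finrank_add_le_finrank_add_finrank K (Submodule.span ℝ {c})
  have h3 := Submodule.finrank_add_finrank_orthogonal K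
  have h4 := finrank_span_le_card (R := ℝ) ({c} : Set (EuclideanSpace ℝ (Fin d)))
  rw [Set.toFinset_singleton, Finset.card_singleton] at h4
  rw [h1, finrank_top] at h2
  refine (Submodule.eq_of_le_of_finrank_le
    ((Submodule.span_singleton_le_iff_mem _ _).2 hmem) ?_).ge
  rw [finrank_span_singleton hne]
  omega

lemma inner_starProjection_of_mem {W : Submodule ℝ (EuclideanSpace ℝ (Fin d))}
    {w : EuclideanSpace ℝ (Fin d)} (hw : w ∈ W) (x : EuclideanSpace ℝ (Fin d)) :
    inner ℝ w (W.starProjection x) = inner ℝ w x := by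
  rw [← Submodule.inner_starProjection_left_eq_right, Submodule.starProjection_eq_self_iff.2 hw]

lemma smul_add_mem_span_pair (t : ℝ) : t • c + z ∈ Submodule.span ℝ {c, z} :=
  Submodule.mem_span_pair.2 ⟨t, 1, by simp⟩

/-- Equal projections make `q` a maximizer too. Then `p - q` is orthogonal to the common tight rows
and to `c`, which together span everything. -/
lemma eq_of_starProjection_eq (hz : IsGenericDirection A c z) {t : ℝ}
    {p q : EuclideanSpace ℝ (Fin d)} (hp : p ∈ polyhedron A b) (hq : q ∈ polyhedron A b)
    (hpmax : ∀ y ∈ polyhedron A b, inner ℝ (t • c + z) y ≤ inner ℝ (t • c + z) p)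
    (hpq : (Submodule.span ℝ {c, z}).starProjection p =
      (Submodule.span ℝ {c, z}).starProjection q) : p = q := by
  have hqmax : ∀ y ∈ polyhedron A b, inner ℝ (t • c + z) y ≤ inner ℝ (t • c + z) q := by
    intro y hy
    rw [← inner_starProjection_of_mem (smul_add_mem_span_pair t) q, ← hpq,
      inner_starProjection_of_mem (smul_add_mem_span_pair t) p]
    exact hpmax y hy
  have h1 := rowSpan_tight_inter_sup_eq_top hz hp hq hpmax hqmax
  have hc : c ∈ Submodule.span ℝ {c, z} := Submodule.subset_span (by simp)
  have h2 : inner ℝ c (p - q) = 0 := by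
    rw [inner_sub_right, ← inner_starProjection_of_mem hc p, hpq, inner_starProjection_of_mem hc q,
      sub_self]
  have h3 : p - q ∈ (rowSpan A (tight A b p ∩ tight A b q) ⊔ Submodule.span ℝ {c})ᗮ := by
    rw [← Submodule.inf_orthogonal]
    exact ⟨sub_mem_rowSpan_tight_inter_orthogonal p q,
      Submodule.mem_orthogonal_singleton_iff_inner_right.2 h2⟩
  rw [h1, Submodule.top_orthogonal_eq_bot, Submodule.mem_bot] at h3
  exact sub_eq_zero.1 h3

lemma starProjection_mem_extremePoints (hz : IsGenericDirection A c z) {t : ℝ}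
    {v : Set.extremePoints ℝ (polyhedron A b)}
    (hv : IsMaximizer (polyhedron A b) (t • c + z) v) :
    (Submodule.span ℝ {c, z}).starProjection v ∈
      Set.extremePoints ℝ ((Submodule.span ℝ {c, z}).starProjection '' polyhedron A b) := by
  refine ⟨⟨v, v.2.1, rfl⟩, ?_⟩
  rintro _ ⟨p, hp, rfl⟩ _ ⟨q, hq, rfl⟩ ⟨r, s, hr, hs, hrs, hv'⟩
  rw [← map_smul, ← map_smul, ← map_add] at hv'
  have hmem : r • p + s • q ∈ polyhedron A b := convex_polyhedron hp hq hr.le hs.le hrs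
  have h1 := eq_of_starProjection_eq hz v.2.1 hmem hv hv'.symm
  rw [v.2.2 hp hq ⟨r, s, hr, hs, hrs, h1.symm⟩]

/-- With finitely many vertices, one of them maximizes `t • c + z` for arbitrarily large `t`; for
such `t` the term in `c` dominates. -/
lemma exists_isMaximizer_and_exists_add (hP : IsCompact (polyhedron A b))
    (hne : (polyhedron A b).Nonempty) (c z : EuclideanSpace ℝ (Fin d)) :
    ∃ v, IsMaximizer (polyhedron A b) c v ∧
      ∃ t : ℝ, IsMaximizer (polyhedron A b) (t • c + z) v := by
  have : Finite (Set.extremePoints ℝ (polyhedron A b)) := finite_extremePoints_polyhedron A b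
  have hfreq : ∃ v, ∃ᶠ t : ℝ in Filter.atTop, IsMaximizer (polyhedron A b) (t • c + z) v := by
    by_contra! h
    obtain ⟨t, ht⟩ := (Filter.eventually_all.2 fun v => h v).exists
    obtain ⟨v, hv⟩ := exists_isMaximizer hP hne (t • c + z)
    exact ht v hv
  obtain ⟨v, hv⟩ := hfreq
  refine ⟨v, fun x hx => ?_, hv.exists⟩
  by_contra! hlt
  have h1 : Filter.Tendsto (fun t : ℝ => t * (inner ℝ c x - inner ℝ c (v : EuclideanSpace ℝ (Fin d))))
      Filter.atTop Filter.atTop := Filter.tendsto_id.atTop_mul_const (sub_pos.2 hlt)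
  obtain ⟨t, ht, ht'⟩ := (hv.and_eventually
    (h1.eventually_gt_atTop (inner ℝ z (v : EuclideanSpace ℝ (Fin d)) - inner ℝ z x))).exists
  have h2 := ht x hx
  rw [inner_add_left, inner_add_left, inner_smul_left, inner_smul_left] at h2
  simp only [conj_trivial] at h2
  linarith

/-- The parameters `t` at which a given vertex is optimal form a closed set, and finitely many of
these cover the connected line. Two components would meet at some `t`, where the two optimal
vertices are adjacent. -/
lemma preconnected_shadowPath (hP : IsCompact (polyhedron A b)) (hne : (polyhedron A b).Nonempty)
    (hz : IsGenericDirection A c z) :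
    ((skeletonGraph (polyhedron A b)).induce
      {v | ∃ t : ℝ, IsMaximizer (polyhedron A b) (t • c + z) v}).Preconnected := by
  have : Finite (Set.extremePoints ℝ (polyhedron A b)) := finite_extremePoints_polyhedron A b
  set V : Set (Set.extremePoints ℝ (polyhedron A b)) :=
    {v | ∃ t : ℝ, IsMaximizer (polyhedron A b) (t • c + z) v} with hV
  intro a a'
  let Λ : V → Set ℝ := fun v => {t | IsMaximizer (polyhedron A b) (t • c + z) v}
  have hclosed : ∀ v, IsClosed (Λ v) := by
    intro v
    have : Λ v = ⋂ x ∈ polyhedron A b, {t : ℝ | inner ℝ (t • c + z) x ≤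
        inner ℝ (t • c + z) ((v : Set.extremePoints ℝ (polyhedron A b)) :
          EuclideanSpace ℝ (Fin d))} := by
      ext t; simp [Λ, IsMaximizer]
    rw [this]
    exact isClosed_biInter fun x _ => isClosed_le (by fun_prop) (by fun_prop)
  let G := (skeletonGraph (polyhedron A b)).induce V
  have hpre := isPreconnected_closed_iff.1 (isPreconnected_univ (α := ℝ))
    (⋃ v ∈ {v | G.Reachable a v}, Λ v) (⋃ v ∈ {v | ¬ G.Reachable a v}, Λ v)
    ((Set.toFinite _).isClosed_biUnion fun v _ => hclosed v)
    ((Set.toFinite _).isClosed_biUnion fun v _ => hclosed v) ?_ ?_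
  · by_contra hna
    obtain ⟨t', ht'⟩ := a'.2
    obtain ⟨t, -, ht1, ht2⟩ := hpre
      ⟨t', trivial, Set.mem_biUnion (show a' ∈ {v | ¬ G.Reachable a v} from hna) ht'⟩
    simp only [Set.mem_iUnion] at ht1 ht2
    obtain ⟨v1, hv1, h1⟩ := ht1
    obtain ⟨v2, hv2, h2⟩ := ht2
    refine hv2 (SimpleGraph.Reachable.trans hv1 (SimpleGraph.Adj.reachable ?_))
    refine adj_of_isMaximizer hz (fun h => ?_) h1 h2
    rw [Subtype.ext h] at hv1
    exact hv2 hv1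
  · intro t _
    obtain ⟨v, hv⟩ := exists_isMaximizer hP hne (t • c + z)
    by_cases h : G.Reachable a ⟨v, t, hv⟩
    · exact Or.inl (Set.mem_biUnion (show _ ∈ {v | G.Reachable a v} from h) hv)
    · exact Or.inr (Set.mem_biUnion (show _ ∈ {v | ¬ G.Reachable a v} from h) hv)
  · obtain ⟨t, ht⟩ := a.2
    exact ⟨t, trivial, Set.mem_biUnion (show _ ∈ {v | G.Reachable a v} from
      SimpleGraph.Reachable.refl a) ht⟩

/-- The shadow path along a generic plane through `c` joins a maximizer of `c` to a minimizer. -/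
theorem exists_combDist_le_shadowVertexCount (hP : IsCompact (polyhedron A b))
    (hne : (polyhedron A b).Nonempty) (hz : IsGenericDirection A c z) :
    ∃ v w, IsMaximizer (polyhedron A b) c v ∧ IsMinimizer (polyhedron A b) c w ∧
      combDist (polyhedron A b) v w ≤ shadowVertexCount (polyhedron A b) c z := by
  classical
  have : Finite (Set.extremePoints ℝ (polyhedron A b)) := finite_extremePoints_polyhedron A b
  obtain ⟨v, hv, hv'⟩ := exists_isMaximizer_and_exists_add hP hne c z
  obtain ⟨w, hw, t, hwt⟩ := exists_isMaximizer_and_exists_add hP hne (-c) z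
  refine ⟨v, w, hv, isMaximizer_neg.1 hw, ?_⟩
  set V : Set (Set.extremePoints ℝ (polyhedron A b)) :=
    {v | ∃ t : ℝ, IsMaximizer (polyhedron A b) (t • c + z) v} with hV
  -- `t • (-c) + z` belongs to the same family with parameter `-t`, so both ends lie on one shadow
  -- path.
  have hwV : w ∈ V := ⟨-t, by simpa using hwt⟩
  have := Fintype.ofFinite V
  obtain ⟨p⟩ := preconnected_shadowPath hP hne hz ⟨v, hv'⟩ ⟨w, hwV⟩
  have hlen := p.toPath.2.length_lt
  let q := p.toPath.1.map (SimpleGraph.Embedding.induce V).toHom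
  have hq : q.length ≤ Fintype.card V := by
    rw [SimpleGraph.Walk.length_map]; exact hlen.le
  have h1 : combDist (polyhedron A b) v w ≤ q.length := SimpleGraph.edist_le q
  refine h1.trans (le_trans (by exact_mod_cast hq : (q.length : ℕ∞) ≤ Fintype.card V) ?_)
  rw [← Nat.card_eq_fintype_card, Nat.card_coe_set_eq, (Set.toFinite V).cast_ncard_eq]
  let f : Set.extremePoints ℝ (polyhedron A b) → EuclideanSpace ℝ (Fin d) :=
    fun v => (Submodule.span ℝ {c, z}).starProjection v
  have hinj : Set.InjOn f V := by
    rintro x ⟨t, hx⟩ y hy hxy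
    exact Subtype.ext (eq_of_starProjection_eq hz x.2.1 y.2.1 hx hxy)
  rw [← hinj.encard_image]
  apply Set.encard_le_encard
  rintro _ ⟨x, ⟨t, hx⟩, rfl⟩
  exact starProjection_mem_extremePoints hz hx

end Shadow

/-! ### Nets on the sphere. -/

section Net

open Module Metric in
/-- Volume bound for the number of separated points on the unit sphere. -/
lemma card_le_of_separated_on_sphere {E : Type*} [NormedAddCommGroup E] [NormedSpace ℝ E]
    [FiniteDimensional ℝ E] {σ : ℝ} (hσ : 0 < σ) (s : Finset E) (hs : ∀ c ∈ s, ‖c‖ = 1)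
    (h : ∀ c ∈ s, ∀ d ∈ s, c ≠ d → σ ≤ ‖c - d‖) : (s.card : ℝ) ≤ (1 + 2 / σ) ^ finrank ℝ E := by
  borelize E
  let μ : Measure E := Measure.addHaar
  obtain ⟨δ, hδ⟩ : ∃ δ, δ = σ / 2 := ⟨_, rfl⟩
  obtain ⟨ρ, hρ⟩ : ∃ ρ, ρ = 1 + σ / 2 := ⟨_, rfl⟩
  have hδ0 : 0 < δ := by linarith
  have hρ0 : 0 < ρ := by linarith
  have hdisj : Set.Pairwise (s : Set E) (Function.onFun Disjoint fun c => ball (c : E) δ) := by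
    rintro c hc d hd hcd
    apply ball_disjoint_ball
    rw [dist_eq_norm]
    linarith [h c hc d hd hcd]
  have hsub : (⋃ c ∈ s, ball (c : E) δ) ⊆ ball (0 : E) ρ := by
    refine Set.iUnion₂_subset fun x hx => ball_subset_ball' ?_
    rw [dist_zero_right, hs x hx]
    linarith
  have hvol : (s.card : ℝ≥0∞) * ENNReal.ofReal (δ ^ finrank ℝ E) * μ (ball 0 1) ≤
      ENNReal.ofReal (ρ ^ finrank ℝ E) * μ (ball 0 1) :=
    calc
      (s.card : ℝ≥0∞) * ENNReal.ofReal (δ ^ finrank ℝ E) * μ (ball 0 1)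
          = μ (⋃ c ∈ s, ball (c : E) δ) := by
        rw [measure_biUnion_finset hdisj fun c _ => measurableSet_ball]
        simp only [μ.addHaar_ball_of_pos _ hδ0]
        simp only [Finset.sum_const, nsmul_eq_mul, mul_assoc]
      _ ≤ μ (ball (0 : E) ρ) := measure_mono hsub
      _ = ENNReal.ofReal (ρ ^ finrank ℝ E) * μ (ball 0 1) := μ.addHaar_ball_of_pos _ hρ0
  have hcard : (s.card : ℝ≥0∞) * ENNReal.ofReal (δ ^ finrank ℝ E) ≤
      ENNReal.ofReal (ρ ^ finrank ℝ E) :=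
    (ENNReal.mul_le_mul_iff_left (measure_ball_pos _ _ zero_lt_one).ne' measure_ball_lt_top.ne).1
      hvol
  have hreal := ENNReal.toReal_le_of_le_ofReal (pow_nonneg hρ0.le _) hcard
  rw [ENNReal.toReal_mul, ENNReal.toReal_natCast,
    ENNReal.toReal_ofReal (pow_nonneg hδ0.le _), ← le_div_iff₀ (pow_pos hδ0 _), ← div_pow] at hreal
  have hquot : 1 + 2 / σ = ρ / δ := by
    rw [hρ, hδ]
    field_simp
    ring
  rwa [hquot]

/-- A maximal `σ`-separated set is a `σ`-net, and the volume bound rules out `N + 1` separated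
points. -/
lemma exists_finite_isDenseOnSphere {d : ℕ} {σ : ℝ} (hσ : 0 < σ) (N : ℕ)
    (hN : (1 + 2 / σ) ^ d < (N : ℝ) + 1) :
    ∃ S : Set (EuclideanSpace ℝ (Fin d)), IsDenseOnSphere σ S ∧ S.encard ≤ N := by
  lift σ to NNReal using hσ.le
  set X := Metric.sphere (0 : EuclideanSpace ℝ (Fin d)) 1 with hX
  have hpack : Metric.packingNumber σ X ≤ N := by
    refine iSup_le fun C => iSup_le fun hC => iSup_le fun hsep => ?_
    by_contra! hlt
    obtain ⟨D, hDC, hD⟩ := Set.exists_subset_encard_eq (Order.add_one_le_of_lt hlt)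
    have hDfin : D.Finite := Set.finite_of_encard_eq_coe (k := N + 1) (by rw [hD]; rfl)
    lift D to Finset (EuclideanSpace ℝ (Fin d)) using hDfin
    have h1 := card_le_of_separated_on_sphere hσ D
      (fun c hc => by simpa [hX] using hC (hDC hc)) (fun c hc e he hce => by
        have h2 : (σ : ℝ≥0∞) < edist c e := hsep (hDC hc) (hDC he) hce
        rw [edist_nndist, ENNReal.coe_lt_coe] at h2
        rw [← dist_eq_norm]
        exact_mod_cast h2.le)
    rw [finrank_euclideanSpace_fin] at h1
    have h3 : D.card = N + 1 := by
      rw [Set.encard_coe_eq_coe_finsetCard] at hD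
      exact_mod_cast hD
    rw [h3] at h1
    push_cast at h1
    linarith
  have htop : Metric.packingNumber σ X ≠ ⊤ := ne_top_of_le_ne_top (ENat.natCast_ne_top N) hpack
  refine ⟨Metric.maximalSeparatedSet σ X, ⟨Metric.maximalSeparatedSet_subset, fun x hx => ?_⟩,
    (Metric.encard_maximalSeparatedSet htop).trans_le hpack⟩
  obtain ⟨y, hy, hxy⟩ := Metric.isCover_maximalSeparatedSet htop hx
  refine ⟨y, hy, ?_⟩
  have h2 : edist x y ≤ σ := hxy
  rw [edist_nndist, ENNReal.coe_le_coe] at h2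
  rw [← dist_eq_norm]
  exact_mod_cast h2

lemma exists_fin_isDenseOnSphere {d : ℕ} (hd : 1 ≤ d) {σ : ℝ} (hσ : 0 < σ) (n : ℕ)
    (hn : (1 + 2 / σ) ^ d < (n : ℝ) + 1) :
    ∃ s : Fin n → EuclideanSpace ℝ (Fin d), IsDenseOnSphere σ (Set.range s) := by
  obtain ⟨S, hS, hcard⟩ := exists_finite_isDenseOnSphere hσ n hn
  have hfin : S.Finite := Set.finite_of_encard_le_coe hcard
  have : Nonempty (Fin d) := ⟨⟨0, hd⟩⟩
  obtain ⟨x, hx⟩ := NormedSpace.sphere_nonempty (x := (0 : EuclideanSpace ℝ (Fin d))) (r := 1) |>.2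
    zero_le_one
  obtain ⟨y, hy, -⟩ := hS.2 x hx
  have := hfin.fintype
  have : Nonempty S := ⟨⟨y, hy⟩⟩
  have hle : Fintype.card S ≤ Fintype.card (Fin n) := by
    rw [← Nat.card_eq_fintype_card, Nat.card_coe_set_eq, Fintype.card_fin]
    have := hfin.cast_ncard_eq.le.trans hcard
    exact_mod_cast this
  obtain ⟨f⟩ := Function.Embedding.nonempty_of_card_le hle
  -- The net may have fewer than `n` points; repetitions fill the remaining rows.
  refine ⟨fun i => (Function.invFun f i : S), ?_⟩
  rwa [Set.range_comp' Subtype.val, (Function.invFun_surjective f.injective).range_eq,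
    Set.image_univ, Subtype.range_coe]

end Net

/-! ### Exponential moments and tails of the Gaussian rows. -/

section GaussianTail

lemma integral_exp_sq_gaussianReal (m : ℝ) {σ : ℝ} (hσ : 0 < σ) :
    ∫ x, Real.exp (7 / 16 * ((x - m) / σ) ^ 2) ∂(gaussianReal m (Real.toNNReal (σ ^ 2))) = √8 := by
  have hv : Real.toNNReal (σ ^ 2) ≠ 0 := by
    rw [Ne, Real.toNNReal_eq_zero, not_le]; positivity
  rw [integral_gaussianReal_eq_integral_smul hv]
  have h1 : ∀ x, gaussianPDFReal m (Real.toNNReal (σ ^ 2)) x •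
      Real.exp (7 / 16 * ((x - m) / σ) ^ 2) =
      (√(2 * Real.pi * σ ^ 2))⁻¹ * Real.exp (-(1 / (16 * σ ^ 2)) * (x - m) ^ 2) := by
    intro x
    rw [gaussianPDFReal_def, Real.coe_toNNReal _ (sq_nonneg σ), smul_eq_mul, mul_assoc,
      ← Real.exp_add]
    congr 2
    field_simp
    ring
  simp_rw [h1]
  rw [integral_const_mul,
    integral_sub_right_eq_self (fun x => Real.exp (-(1 / (16 * σ ^ 2)) * x ^ 2)) m,
    integral_gaussian, ← Real.sqrt_inv, ← Real.sqrt_mul (by positivity)]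
  congr 1
  have := Real.pi_pos
  field_simp
  norm_num

lemma integrable_exp_sq_gaussianReal (m : ℝ) {σ : ℝ} (hσ : 0 < σ) :
    Integrable (fun x => Real.exp (7 / 16 * ((x - m) / σ) ^ 2))
      (gaussianReal m (Real.toNNReal (σ ^ 2))) := by
  by_contra h
  have h1 := integral_exp_sq_gaussianReal m hσ
  rw [integral_undef h] at h1
  -- A nonintegrable function has integral `0` by convention, so the nonzero value already proves
  -- integrability.
  have : (0 : ℝ) < √8 := by positivity
  linarith

variable {n d : ℕ}

instance (Abar : Fin n → Fin d → ℝ) (bbar : Fin n → ℝ) (σ : ℝ) :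
    IsProbabilityMeasure (smoothedLaw Abar bbar σ) := by
  unfold smoothedLaw; infer_instance

/-- Chernoff bound for the squared distance of a random row from its mean. -/
lemma smoothedLaw_real_row_le (Abar : Fin n → Fin d → ℝ) (bbar : Fin n → ℝ) {σ : ℝ} (hσ : 0 < σ)
    (K : ℝ) (i : Fin n) :
    (smoothedLaw Abar bbar σ).real
      {p | K * σ ^ 2 ≤ ∑ j, (p.1 i j - Abar i j) ^ 2 + (p.2 i - bbar i) ^ 2} ≤
      Real.exp (-(7 / 16 * K)) * √8 ^ (d + 1) := by
  let φ : ℝ → ℝ → ℝ := fun m x => Real.exp (7 / 16 * ((x - m) / σ) ^ 2)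
  let v := Real.toNNReal (σ ^ 2)
  have hint : ∀ m, Integrable (φ m) (gaussianReal m v) := fun m =>
    integrable_exp_sq_gaussianReal m hσ
  let F : (Fin d → ℝ) → ℝ := fun a => ∏ j, φ (Abar i j) (a j)
  have hF : Integrable F (Measure.pi fun j => gaussianReal (Abar i j) v) :=
    Integrable.fintype_prod_dep fun j => hint (Abar i j)
  have hF' : Integrable (fun A : Fin n → Fin d → ℝ => F (A i))
      (Measure.pi fun i => Measure.pi fun j => gaussianReal (Abar i j) v) :=
    integrable_comp_eval hF
  have hG' : Integrable (fun b : Fin n → ℝ => φ (bbar i) (b i))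
      (Measure.pi fun i => gaussianReal (bbar i) v) :=
    integrable_comp_eval (hint (bbar i))
  have hFG : Integrable (fun p : (Fin n → Fin d → ℝ) × (Fin n → ℝ) => F (p.1 i) * φ (bbar i) (p.2 i))
      (smoothedLaw Abar bbar σ) := hF'.mul_prod hG'
  have hval : ∫ p, F (p.1 i) * φ (bbar i) (p.2 i) ∂(smoothedLaw Abar bbar σ) = √8 ^ (d + 1) := by
    unfold smoothedLaw
    rw [integral_prod_mul (fun A : Fin n → Fin d → ℝ => F (A i))
      (fun b : Fin n → ℝ => φ (bbar i) (b i)), integral_comp_eval hF.aestronglyMeasurable,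
      integral_comp_eval (hint (bbar i)).aestronglyMeasurable, integral_fintype_prod_eq_prod,
      integral_exp_sq_gaussianReal _ hσ]
    rw [Finset.prod_congr rfl fun j _ => integral_exp_sq_gaussianReal (Abar i j) hσ]
    simp [pow_succ]
  have hexp : ∀ p : (Fin n → Fin d → ℝ) × (Fin n → ℝ), F (p.1 i) * φ (bbar i) (p.2 i) =
      Real.exp (7 / 16 / σ ^ 2 * (∑ j, (p.1 i j - Abar i j) ^ 2 + (p.2 i - bbar i) ^ 2)) := by
    intro p
    simp only [F, φ]
    rw [← Real.exp_sum, ← Real.exp_add, mul_add, Finset.mul_sum]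
    congr 2
    · refine Finset.sum_congr rfl fun j _ => ?_
      field_simp
    · field_simp
  have hmarkov := mul_meas_ge_le_integral_of_nonneg
    (Filter.Eventually.of_forall fun p => by rw [hexp]; positivity) hFG (Real.exp (7 / 16 * K))
  rw [hval] at hmarkov
  have hset : {p : (Fin n → Fin d → ℝ) × (Fin n → ℝ) |
      K * σ ^ 2 ≤ ∑ j, (p.1 i j - Abar i j) ^ 2 + (p.2 i - bbar i) ^ 2} ⊆
      {p | Real.exp (7 / 16 * K) ≤ F (p.1 i) * φ (bbar i) (p.2 i)} := by
    intro p hp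
    rw [Set.mem_ofPred_eq] at hp ⊢
    rw [hexp, Real.exp_le_exp]
    calc 7 / 16 * K = 7 / 16 / σ ^ 2 * (K * σ ^ 2) := by field_simp
      _ ≤ _ := by gcongr
  rw [Real.exp_neg, ← div_eq_inv_mul, le_div_iff₀ (Real.exp_pos _), mul_comm]
  exact (mul_le_mul_of_nonneg_left (measureReal_mono hset) (Real.exp_pos _).le).trans hmarkov

end GaussianTail

/-! ### Null sets: general position and generic directions. -/

section NullSets

variable {n d : ℕ}

/-- The closed set is `σ`-compact, hence so is its projection, a countable union of compact sets. -/
lemma measurableSet_exists_of_isClosed {X Y : Type*} [TopologicalSpace X] [T2Space X]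
    [MeasurableSpace X] [OpensMeasurableSpace X] [TopologicalSpace Y] [SigmaCompactSpace X]
    [SigmaCompactSpace Y] {p : X → Y → Prop} (h : IsClosed {q : X × Y | p q.1 q.2}) :
    MeasurableSet {x | ∃ y, p x y} := by
  have h1 : IsSigmaCompact {q : X × Y | p q.1 q.2} :=
    isSigmaCompact_univ.of_isClosed_subset h (Set.subset_univ _)
  obtain ⟨K, hK, hKU⟩ := h1.image continuous_fst
  have h2 : {x | ∃ y, p x y} = ⋃ i, K i := by
    rw [hKU]
    ext x
    simp
  rw [h2]
  exact MeasurableSet.iUnion fun i => (hK i).measurableSet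

/-- Fubini in a coordinate with nonzero coefficient: each fibre contains at most one point. -/
lemma pi_setOf_linear_eq_zero (μ : Fin n → Measure ℝ) [∀ i, IsProbabilityMeasure (μ i)]
    (hμ : ∀ i x, μ i {x} = 0) (φ : Module.Dual ℝ (Fin n → ℝ)) (hφ : φ ≠ 0) :
    Measure.pi μ {b | φ b = 0} = 0 := by
  obtain ⟨i, hi⟩ : ∃ i, φ (Pi.single i 1) ≠ 0 := by
    by_contra! h
    exact hφ (LinearMap.pi_ext' fun i => LinearMap.ext_ring (by simpa using h i))
  cases n with
  | zero => exact i.elim0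
  | succ m =>
    have hcont : Continuous φ := φ.continuous_of_finiteDimensional
    have hmp := measurePreserving_piFinSuccAbove μ i
    have hmeas : MeasurableSet {b | φ b = 0} := (isClosed_eq hcont continuous_const).measurableSet
    rw [← hmp.symm.measure_preimage_equiv, Measure.prod_apply_symm
      ((MeasurableEquiv.piFinSuccAbove (fun _ => ℝ) i).symm.measurable hmeas),
      lintegral_eq_zero_iff' (Measurable.aemeasurable (measurable_measure_prodMk_right
        ((MeasurableEquiv.piFinSuccAbove (fun _ => ℝ) i).symm.measurable hmeas)))]
    refine Filter.Eventually.of_forall fun y => ?_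
    refine Set.Subsingleton.induction_on (p := fun s => μ i s = 0) ?_ measure_empty (hμ i)
    intro s hs t ht
    simp only [Set.mem_preimage, Set.mem_ofPred_eq, MeasurableEquiv.piFinSuccAbove_symm_apply] at hs ht
    change φ (Fin.insertNth (α := fun _ => ℝ) i s y) = 0 at hs
    change φ (Fin.insertNth (α := fun _ => ℝ) i t y) = 0 at ht
    have h1 : ∀ r : ℝ, Fin.insertNth (α := fun _ => ℝ) i r y =
        Fin.insertNth (α := fun _ => ℝ) i 0 y + r • Pi.single i 1 := by
      intro r
      ext j
      rcases eq_or_ne j i with rfl | hj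
      · simp
      · obtain ⟨k, rfl⟩ := Fin.exists_succAbove_eq hj
        simp
    rw [h1 s, map_add, map_smul, smul_eq_mul] at hs
    rw [h1 t, map_add, map_smul, smul_eq_mul] at ht
    have : (s - t) * φ (Pi.single i 1) = 0 := by linarith
    exact sub_eq_zero.1 ((mul_eq_zero.1 this).resolve_right hi)

lemma measurableSet_exists_common_point (J : Finset (Fin n)) :
    MeasurableSet {p : (Fin n → Fin d → ℝ) × (Fin n → ℝ) |
      ∃ x : EuclideanSpace ℝ (Fin d), ∀ i ∈ J, inner ℝ (row p.1 i) x = p.2 i} := by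
  apply measurableSet_exists_of_isClosed
  simp only [inner_row, Set.ofPred_forall]
  exact isClosed_biInter fun i _ => isClosed_eq (by fun_prop) (by fun_prop)

/-- Almost surely no `d + 1` of the hyperplanes have a common point. -/
lemma smoothedLaw_exists_common_point (Abar : Fin n → Fin d → ℝ) (bbar : Fin n → ℝ) {σ : ℝ}
    (hσ : 0 < σ) {J : Finset (Fin n)} (hJ : d < J.card) :
    smoothedLaw Abar bbar σ {p | ∃ x : EuclideanSpace ℝ (Fin d),
      ∀ i ∈ J, inner ℝ (row p.1 i) x = p.2 i} = 0 := by
  unfold smoothedLaw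
  rw [Measure.measure_prod_null (measurableSet_exists_common_point J)]
  refine Filter.Eventually.of_forall fun A => ?_
  -- With `A` fixed, a common point puts the restriction of `b` to `J` in the range of `L`. This
  -- range is proper because `d < J.card`, so a nonzero functional vanishes on it.
  let L : EuclideanSpace ℝ (Fin d) →ₗ[ℝ] (J → ℝ) :=
    LinearMap.pi fun i => (innerₛₗ ℝ (row A i))
  have hL : LinearMap.range L < ⊤ := by
    rw [lt_top_iff_ne_top]
    intro h
    have h1 := LinearMap.finrank_range_le L
    rw [h, finrank_top] at h1
    simp at h1
    omega
  obtain ⟨f, hf0, hf⟩ := Submodule.exists_le_ker_of_lt_top _ hL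
  let r : (Fin n → ℝ) →ₗ[ℝ] (J → ℝ) := LinearMap.funLeft ℝ ℝ Subtype.val
  have hr : Function.Surjective r :=
    LinearMap.funLeft_surjective_of_injective _ _ _ Subtype.val_injective
  have hφ : f ∘ₗ r ≠ 0 := by
    intro h
    apply hf0
    refine LinearMap.ext fun y => ?_
    obtain ⟨x, rfl⟩ := hr y
    exact LinearMap.congr_fun h x
  have hv : Real.toNNReal (σ ^ 2) ≠ 0 := by
    rw [Ne, Real.toNNReal_eq_zero, not_le]; positivity
  refine measure_mono_null ?_ (pi_setOf_linear_eq_zero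
    (fun i => gaussianReal (bbar i) (Real.toNNReal (σ ^ 2))) (fun i x => ?_) _ hφ)
  · rintro b ⟨x, hx⟩
    have : r b = L x := by
      ext i
      exact (hx i i.2).symm
    rw [Set.mem_ofPred_eq, LinearMap.comp_apply, this]
    exact hf ⟨x, rfl⟩
  · have := nullSingletonClass_gaussianReal (μ := bbar i) hv
    exact measure_singleton x

lemma IsSphericallySymmetric.measure_orthogonal_eq {ν : Measure (EuclideanSpace ℝ (Fin d))}
    (hν : IsSphericallySymmetric ν) {e e' : EuclideanSpace ℝ (Fin d)} (he : e ≠ 0) (he' : e' ≠ 0) :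
    ν {z | inner ℝ e z = 0} = ν {z | inner ℝ e' z = 0} := by
  obtain ⟨f, hf⟩ : ∃ f, f = (‖e'‖ / ‖e‖) • e := ⟨_, rfl⟩
  have hen := norm_pos_iff.2 he
  have hen' := norm_pos_iff.2 he'
  have hfn : ‖e'‖ = ‖f‖ := by
    rw [hf, norm_smul, norm_div, norm_norm, norm_norm]; field_simp
  -- After `e` is rescaled to the length of `e'`, a reflection exchanges the two hyperplanes.
  let U := (Submodule.span ℝ {e' - f})ᗮ.reflection
  have hU : U e' = f := Submodule.reflection_sub hfn
  rw [← hν.2.2 U, Measure.map_apply U.continuous.measurable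
    (isClosed_eq (by fun_prop) continuous_const).measurableSet, hν.2.2 U]
  congr 1
  ext z
  rw [Set.mem_preimage, Set.mem_ofPred_eq, Set.mem_ofPred_eq, ← U.inner_map_map e' z, hU, hf,
    inner_smul_left]
  simp [he, he']

/-- A rotation invariant law that does not charge the origin charges no hyperplane. -/
lemma IsSphericallySymmetric.measure_orthogonal_eq_zero
    {ν : Measure (EuclideanSpace ℝ (Fin d))} (hν : IsSphericallySymmetric ν)
    {e : EuclideanSpace ℝ (Fin d)} (he : e ≠ 0) : ν {z | inner ℝ e z = 0} = 0 := by
  classical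
  have := hν.1
  by_contra hne
  cases d with
  | zero => exact he (Subsingleton.elim _ _)
  | succ m =>
  -- Points of the moment curve: a nonzero `z` is orthogonal to at most `m` of them, as these are
  -- roots of a nonzero polynomial of degree at most `m`. Infinitely many hyperplanes of equal
  -- positive mass would contradict this.
  let g : ℕ → EuclideanSpace ℝ (Fin (m + 1)) := fun k =>
    WithLp.toLp 2 fun j => (k : ℝ) ^ (j : ℕ)
  have hg : ∀ k, g k ≠ 0 := by
    intro k h
    have := congrArg (fun x : EuclideanSpace ℝ (Fin (m + 1)) => x 0) h
    simp [g] at this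
  have hmeas : ∀ k, MeasurableSet {z | inner ℝ (g k) z = 0} := fun k =>
    (isClosed_eq (by fun_prop) continuous_const).measurableSet
  obtain ⟨N, hN⟩ := ENNReal.exists_nat_mul_gt hne (ENNReal.natCast_ne_top (m + 1))
  have hsum : (N : ℝ≥0∞) * ν {z | inner ℝ e z = 0} =
      ∫⁻ z, ∑ k ∈ Finset.range N, Set.indicator {z | inner ℝ (g k) z = 0} 1 z ∂ν := by
    rw [lintegral_finsetSum _ fun k _ => measurable_one.indicator (hmeas k)]
    simp_rw [lintegral_indicator_one (hmeas _), hν.measure_orthogonal_eq (hg _) he]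
    simp
  have hle : ∫⁻ z, ∑ k ∈ Finset.range N, Set.indicator {z | inner ℝ (g k) z = 0} 1 z ∂ν ≤
      ∫⁻ _, ((m + 1 : ℕ) : ℝ≥0∞) ∂ν := by
    have h0 : ∀ᵐ z ∂ν, z ≠ 0 := by
      rw [ae_iff]; simpa using hν.2.1
    refine lintegral_mono_ae (h0.mono fun z hz => ?_)
    let P : Polynomial ℝ := ∑ j : Fin (m + 1), Polynomial.monomial (j : ℕ) (z j)
    have hcoeff : ∀ j : Fin (m + 1), P.coeff j = z j := by
      intro j
      simp [P, Polynomial.finsetSum_coeff, Polynomial.coeff_monomial, Fin.val_inj]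
    have hP : P ≠ 0 := by
      intro h
      apply hz
      ext j
      rw [← hcoeff j, h]; simp
    have hdeg : P.natDegree ≤ m :=
      Polynomial.natDegree_sum_le_of_forall_le _ _ fun j _ =>
        (Polynomial.natDegree_monomial_le _).trans (Nat.lt_succ_iff.1 j.2)
    have heval : ∀ k : ℕ, inner ℝ (g k) z = P.eval (k : ℝ) := by
      intro k
      simp [P, g, PiLp.inner_apply, Polynomial.eval_finsetSum]
    have hcard : ((Finset.range N).filter fun k => inner ℝ (g k) z = 0).card ≤ m := by
      refine le_trans ?_ (P.card_roots'.trans hdeg)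
      rw [← Finset.card_image_of_injective _ (Nat.cast_injective (R := ℝ))]
      refine (Finset.card_le_card ?_).trans (Multiset.toFinset_card_le _)
      intro x hx
      obtain ⟨k, hk, rfl⟩ := Finset.mem_image.1 hx
      rw [Multiset.mem_toFinset, Polynomial.mem_roots hP, Polynomial.IsRoot.def, ← heval]
      exact (Finset.mem_filter.1 hk).2
    have : ∑ k ∈ Finset.range N, Set.indicator {z | inner ℝ (g k) z = 0} (1 : EuclideanSpace ℝ (Fin (m + 1)) → ℝ≥0∞) z =
        ((Finset.range N).filter fun k => inner ℝ (g k) z = 0).card := by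
      rw [Finset.card_filter]
      push_cast
      refine Finset.sum_congr rfl fun k _ => ?_
      simp [Set.indicator_apply]
    rw [this]
    exact_mod_cast hcard.trans (Nat.le_succ m)
  rw [lintegral_const, measure_univ, mul_one] at hle
  exact absurd (hsum.le.trans hle) (not_le.2 hN)

lemma IsSphericallySymmetric.measure_submodule_eq_zero
    {ν : Measure (EuclideanSpace ℝ (Fin d))} (hν : IsSphericallySymmetric ν)
    {V : Submodule ℝ (EuclideanSpace ℝ (Fin d))} (hV : V ≠ ⊤) : ν V = 0 := by
  obtain ⟨e, he, he0⟩ := Submodule.exists_mem_ne_zero_of_ne_bot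
    (mt Submodule.orthogonal_eq_bot_iff.1 hV)
  refine measure_mono_null (fun z hz => ?_) (hν.measure_orthogonal_eq_zero he0)
  exact (Submodule.mem_orthogonal' _ _).1 he z hz

/-- Properness of the span is witnessed by a unit normal vector and membership by coefficients.
These conditions are closed in the data and witnesses jointly, which yields measurability; hence
norm `1` instead of merely nonzero. -/
lemma not_isGenericDirection_iff {A : Fin n → Fin d → ℝ} {c z : EuclideanSpace ℝ (Fin d)} :
    ¬ IsGenericDirection A c z ↔ ∃ I : Finset (Fin n),
      ∃ y : EuclideanSpace ℝ (Fin d) × (I → ℝ) × ℝ,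
        ‖y.1‖ = 1 ∧ inner ℝ c y.1 = 0 ∧ (∀ i ∈ I, inner ℝ (row A i) y.1 = 0) ∧
          z = ∑ i : I, y.2.1 i • row A i + y.2.2 • c := by
  unfold IsGenericDirection
  push Not
  refine exists_congr fun I => ?_
  have hmem : z ∈ rowSpan A I ⊔ Submodule.span ℝ {c} ↔
      ∃ q : I → ℝ, ∃ r : ℝ, z = ∑ i : I, q i • row A i + r • c := by
    rw [Submodule.mem_sup]
    constructor
    · rintro ⟨y, hy, y', hy', rfl⟩
      obtain ⟨r, rfl⟩ := Submodule.mem_span_singleton.1 hy'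
      obtain ⟨q, rfl⟩ := (Submodule.mem_span_image_finset_iff_exists_fun ℝ).1 hy
      exact ⟨q, r, rfl⟩
    · rintro ⟨q, r, rfl⟩
      have hrow : ∀ i : I, q i • row A i ∈ rowSpan A I := fun i =>
        Submodule.smul_mem _ _ (Submodule.subset_span ⟨i, i.2, rfl⟩)
      exact ⟨_, Submodule.sum_mem _ fun i _ => hrow i, _,
        Submodule.smul_mem _ _ (Submodule.mem_span_singleton_self c), rfl⟩
  have htop : rowSpan A I ⊔ Submodule.span ℝ {c} ≠ ⊤ ↔
      ∃ x, ‖x‖ = 1 ∧ inner ℝ c x = 0 ∧ ∀ i ∈ I, inner ℝ (row A i) x = 0 := by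
    have hx : ∀ x, x ∈ (rowSpan A I ⊔ Submodule.span ℝ {c})ᗮ ↔
        inner ℝ c x = 0 ∧ ∀ i ∈ I, inner ℝ (row A i) x = 0 := by
      intro x
      rw [← Submodule.inf_orthogonal, Submodule.mem_inf, mem_rowSpan_orthogonal,
        Submodule.mem_orthogonal_singleton_iff_inner_right, and_comm]
    rw [Ne, ← Submodule.orthogonal_eq_bot_iff, Submodule.eq_bot_iff]
    push Not
    constructor
    · rintro ⟨x, hxm, hx0⟩
      have hxn := norm_pos_iff.2 hx0
      refine ⟨‖x‖⁻¹ • x, ?_, (hx _).1 (Submodule.smul_mem _ _ hxm)⟩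
      rw [norm_smul, norm_inv, norm_norm, inv_mul_cancel₀ hxn.ne']
    · rintro ⟨x, hx1, hx2⟩
      exact ⟨x, (hx x).2 hx2, fun h => by simp [h] at hx1⟩
  rw [hmem, htop]
  constructor
  · rintro ⟨⟨x, hx1, hx2, hx3⟩, q, r, hz⟩
    exact ⟨⟨x, q, r⟩, hx1, hx2, hx3, hz⟩
  · rintro ⟨⟨x, q, r⟩, hx1, hx2, hx3, hz⟩
    exact ⟨⟨x, hx1, hx2, hx3⟩, q, r, hz⟩

lemma measurableSet_not_isGenericDirection (c : EuclideanSpace ℝ (Fin d)) :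
    MeasurableSet {ω : ((Fin n → Fin d → ℝ) × (Fin n → ℝ)) × EuclideanSpace ℝ (Fin d) |
      ¬ IsGenericDirection ω.1.1 c ω.2} := by
  simp only [not_isGenericDirection_iff, Set.ofPred_exists]
  refine MeasurableSet.iUnion fun I => ?_
  simp only [← Set.ofPred_exists]
  apply measurableSet_exists_of_isClosed
  have hrow : ∀ i, Continuous fun A : Fin n → Fin d → ℝ => row A i := by
    intro i; unfold row; fun_prop
  simp only [Set.ofPred_and, Set.ofPred_forall]
  refine (isClosed_eq (by fun_prop) continuous_const).inter
    ((isClosed_eq (by fun_prop) continuous_const).inter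
      ((isClosed_biInter fun i _ => isClosed_eq ?_ continuous_const).inter (isClosed_eq ?_ ?_)))
  all_goals fun_prop

lemma IsSphericallySymmetric.ae_isGenericDirection {ν : Measure (EuclideanSpace ℝ (Fin d))}
    (hν : IsSphericallySymmetric ν) (A : Fin n → Fin d → ℝ) (c : EuclideanSpace ℝ (Fin d)) :
    ∀ᵐ z ∂ν, IsGenericDirection A c z := by
  unfold IsGenericDirection
  rw [ae_all_iff]
  intro I
  by_cases h : rowSpan A I ⊔ Submodule.span ℝ {c} = ⊤
  · simp [h]
  · have := hν.measure_submodule_eq_zero h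
    rw [ae_iff]
    simpa [h] using this

lemma IsSphericallySymmetric.ae_prod_isGenericDirection
    {ν : Measure (EuclideanSpace ℝ (Fin d))} (hν : IsSphericallySymmetric ν)
    (μ : Measure ((Fin n → Fin d → ℝ) × (Fin n → ℝ))) (c : EuclideanSpace ℝ (Fin d)) :
    ∀ᵐ ω ∂(μ.prod ν), IsGenericDirection ω.1.1 c ω.2 := by
  have := hν.1
  rw [ae_iff, Measure.measure_prod_null (measurableSet_not_isGenericDirection c)]
  exact Filter.Eventually.of_forall fun p => hν.ae_isGenericDirection p.1 c

end NullSets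

/-! ### Choice of constants and assembly. -/

section Main

variable {n d : ℕ}

lemma one_le_log_four_div {σ : ℝ} (hσ : 0 < σ) (hσ1 : σ ≤ 1) : 1 ≤ Real.log (4 / σ) := by
  rw [Real.le_log_iff_exp_le (by positivity)]
  have h1 : (4 : ℝ) ≤ 4 / σ := by
    rw [le_div_iff₀ hσ]; linarith
  linarith [Real.exp_one_lt_d9]

lemma le_one_div_sixty_four {σ : ℝ} (hd : 2 ≤ d) (hσ : 0 < σ) (hσ1 : σ ≤ 1)
    (hσd : σ * √(Real.log (4 / σ)) ≤ 1 / (32 * (d : ℝ))) : σ ≤ 1 / 64 := by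
  have h1 : 1 ≤ √(Real.log (4 / σ)) := Real.one_le_sqrt.2 (one_le_log_four_div hσ hσ1)
  have hd' : (2 : ℝ) ≤ d := by exact_mod_cast hd
  calc σ ≤ σ * √(Real.log (4 / σ)) := le_mul_of_one_le_right hσ.le h1
    _ ≤ 1 / (32 * (d : ℝ)) := hσd
    _ ≤ 1 / 64 := by
      apply one_div_le_one_div_of_le <;> linarith

lemma chernoff_union_le {σ : ℝ} (hd : 2 ≤ d) (hσ : 0 < σ) (hσ64 : σ ≤ 1 / 64) (hn0 : 0 < n)
    (hn : (n : ℝ) ≤ (4 / σ) ^ d) :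
    n * (Real.exp (-(7 / 16 * (4 * d ^ 2 * Real.log (4 / σ)))) * √8 ^ (d + 1)) ≤
      1 / (n : ℝ) ^ d := by
  have hd' : (2 : ℝ) ≤ d := by exact_mod_cast hd
  obtain ⟨l, hl⟩ : ∃ l, l = Real.log (4 / σ) := ⟨_, rfl⟩
  have hy : 256 ≤ 4 / σ := by
    rw [le_div_iff₀ hσ]; linarith
  have hexpl : Real.exp l = 4 / σ := by rw [hl, Real.exp_log (by positivity)]
  have hl0 : 0 ≤ l := by
    rw [hl]; exact Real.log_nonneg (by linarith)
  rw [← hl]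
  have hn' : (n : ℝ) ≤ Real.exp (d * l) := by
    rw [Real.exp_nat_mul, hexpl]; exact hn
  have h8 : √8 ≤ Real.exp (l / 4) := by
    have h1 : (4 : ℝ) ≤ Real.exp (l / 4) := by
      apply le_of_pow_le_pow_left₀ (n := 4) (by norm_num) (Real.exp_pos _).le
      rw [← Real.exp_nat_mul]
      norm_num
      rw [mul_div_cancel₀ l (by norm_num), hexpl]
      exact hy
    refine le_trans ?_ h1
    rw [Real.sqrt_le_left (by norm_num)]
    norm_num
  have hmain : ((n : ℝ) * √8) ^ (d + 1) ≤ Real.exp (7 / 16 * (4 * d ^ 2 * l)) := by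
    calc ((n : ℝ) * √8) ^ (d + 1) ≤ (Real.exp (d * l) * Real.exp (l / 4)) ^ (d + 1) := by gcongr
      _ = Real.exp (((d : ℝ) + 1) * (d * l + l / 4)) := by
        rw [← Real.exp_add, ← Real.exp_nat_mul]; push_cast; rfl
      _ ≤ _ := by
        rw [Real.exp_le_exp]
        -- The exponents compare because `2 ≤ d`; the summand `1 / 4` comes from `√8 ≤ exp (l / 4)`,
        -- valid as `4 / σ ≥ 256`.
        have : ((d : ℝ) + 1) * (d + 1 / 4) ≤ 7 / 4 * d ^ 2 := by nlinarith
        nlinarith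
  have hn0' : (0 : ℝ) < n := by exact_mod_cast hn0
  rw [le_div_iff₀ (by positivity), Real.exp_neg]
  have h2 : (n : ℝ) * ((Real.exp (7 / 16 * (4 * d ^ 2 * l)))⁻¹ * √8 ^ (d + 1)) * (n : ℝ) ^ d =
      ((n : ℝ) * √8) ^ (d + 1) / Real.exp (7 / 16 * (4 * d ^ 2 * l)) := by
    rw [mul_pow]; field_simp; ring
  rw [h2]
  exact div_le_one_of_le₀ hmain (Real.exp_pos _).le

/-- The data `(A, b)` that are close to their means and in general position. -/
def goodData (Abar : Fin n → Fin d → ℝ) (bbar : Fin n → ℝ) (ρ : ℝ) :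
    Set ((Fin n → Fin d → ℝ) × (Fin n → ℝ)) :=
  {p | (∀ i, ∑ j, (p.1 i j - Abar i j) ^ 2 + (p.2 i - bbar i) ^ 2 < ρ) ∧
    ∀ J : Finset (Fin n), d < J.card →
      ¬ ∃ x : EuclideanSpace ℝ (Fin d), ∀ i ∈ J, inner ℝ (row p.1 i) x = p.2 i}

lemma measurableSet_goodData (Abar : Fin n → Fin d → ℝ) (bbar : Fin n → ℝ) (ρ : ℝ) :
    MeasurableSet (goodData Abar bbar ρ) := by
  unfold goodData
  simp only [Set.ofPred_and, Set.ofPred_forall]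
  refine (MeasurableSet.iInter fun i => measurableSet_lt (by fun_prop) measurable_const).inter
    (MeasurableSet.iInter fun J => MeasurableSet.iInter fun _ =>
      (measurableSet_exists_common_point J).compl)

lemma smoothedLaw_real_goodData (Abar : Fin n → Fin d → ℝ) (bbar : Fin n → ℝ) {σ : ℝ}
    (hσ : 0 < σ) (K : ℝ) :
    1 - n * (Real.exp (-(7 / 16 * K)) * √8 ^ (d + 1)) ≤
      (smoothedLaw Abar bbar σ).real (goodData Abar bbar (K * σ ^ 2)) := by
  have h1 := probReal_compl_eq_one_sub (μ := smoothedLaw Abar bbar σ)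
    (measurableSet_goodData Abar bbar (K * σ ^ 2))
  let B : Fin n → Set ((Fin n → Fin d → ℝ) × (Fin n → ℝ)) := fun i =>
    {p | K * σ ^ 2 ≤ ∑ j, (p.1 i j - Abar i j) ^ 2 + (p.2 i - bbar i) ^ 2}
  let D : Finset (Fin n) → Set ((Fin n → Fin d → ℝ) × (Fin n → ℝ)) := fun J =>
    {p | d < J.card ∧ ∃ x : EuclideanSpace ℝ (Fin d), ∀ i ∈ J, inner ℝ (row p.1 i) x = p.2 i}
  have hsub : (goodData Abar bbar (K * σ ^ 2))ᶜ ⊆ (⋃ i, B i) ∪ ⋃ J, D J := by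
    intro p hp
    by_contra h
    simp only [Set.mem_union, Set.mem_iUnion, not_or, not_exists] at h
    exact hp ⟨fun i => not_le.1 (h.1 i), fun J hJ hx => h.2 J ⟨hJ, hx⟩⟩
  have hD : smoothedLaw Abar bbar σ (⋃ J, D J) = 0 := by
    rw [measure_iUnion_null_iff]
    intro J
    by_cases hJ : d < J.card
    · refine measure_mono_null (fun p hp => ?_) (smoothedLaw_exists_common_point Abar bbar hσ hJ)
      exact hp.2
    · have : D J = ∅ := Set.eq_empty_of_forall_notMem fun p hp => hJ hp.1
      rw [this, measure_empty]
  have hle : (smoothedLaw Abar bbar σ).real (goodData Abar bbar (K * σ ^ 2))ᶜ ≤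
      n * (Real.exp (-(7 / 16 * K)) * √8 ^ (d + 1)) := by
    calc (smoothedLaw Abar bbar σ).real (goodData Abar bbar (K * σ ^ 2))ᶜ
        ≤ (smoothedLaw Abar bbar σ).real ((⋃ i, B i) ∪ ⋃ J, D J) := measureReal_mono hsub
      _ ≤ (smoothedLaw Abar bbar σ).real (⋃ i, B i) + (smoothedLaw Abar bbar σ).real (⋃ J, D J) :=
        measureReal_union_le _ _
      _ = (smoothedLaw Abar bbar σ).real (⋃ i, B i) := by
        rw [measureReal_def _ (⋃ J, D J), hD, ENNReal.toReal_zero, add_zero]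
      _ ≤ ∑ i, (smoothedLaw Abar bbar σ).real (B i) := measureReal_iUnion_fintype_le _
      _ ≤ ∑ _i : Fin n, Real.exp (-(7 / 16 * K)) * √8 ^ (d + 1) :=
        Finset.sum_le_sum fun i _ => smoothedLaw_real_row_le Abar bbar hσ K i
      _ = _ := by simp
  linarith

lemma norm_add_abs_le_of_mem_goodData {s : Fin n → EuclideanSpace ℝ (Fin d)}
    {bbar : Fin n → ℝ} (hb : ∀ i, √2 * bbar i = 1) {T : ℝ} (hT : 0 ≤ T)
    {p : (Fin n → Fin d → ℝ) × (Fin n → ℝ)}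
    (hp : p ∈ goodData (fun i => (√2)⁻¹ • (s i).ofLp) bbar ((2 * T) ^ 2)) (i : Fin n) :
    ‖√2 • row p.1 i - s i‖ + |√2 * p.2 i - 1| ≤ 4 * T := by
  have h2 : (0 : ℝ) < √2 := by positivity
  have h22 : √2 ^ 2 = (2 : ℝ) := Real.sq_sqrt (by norm_num)
  have h1 := (hp.1 i).le
  have h3 : ‖√2 • row p.1 i - s i‖ ^ 2 =
      2 * ∑ j, (p.1 i j - ((√2)⁻¹ • (s i).ofLp) j) ^ 2 := by
    rw [EuclideanSpace.norm_sq_eq, Finset.mul_sum]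
    refine Finset.sum_congr rfl fun j _ => ?_
    simp only [row, PiLp.sub_apply, PiLp.smul_apply, smul_eq_mul, Pi.smul_apply, Real.norm_eq_abs,
      sq_abs]
    have : p.1 i j - (√2)⁻¹ * (s i).ofLp j = (√2)⁻¹ * (√2 * p.1 i j - (s i).ofLp j) := by
      field_simp
    rw [this, mul_pow, inv_pow, h22]
    ring
  have h4 : |√2 * p.2 i - 1| ^ 2 = 2 * (p.2 i - bbar i) ^ 2 := by
    rw [sq_abs, ← hb i, ← mul_sub, mul_pow, h22]
  have h5 := norm_nonneg (√2 • row p.1 i - s i)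
  have h6 := abs_nonneg (√2 * p.2 i - 1)
  refine abs_le_of_sq_le_sq' ?_ (by linarith) |>.2
  -- `(x + y)² ≤ 2 (x² + y²)`, where the squares sum to at most `2 * (2T)²`.
  nlinarith [sq_nonneg (‖√2 • row p.1 i - s i‖ - |√2 * p.2 i - 1|)]

lemma card_tight_le_of_mem_goodData {Abar : Fin n → Fin d → ℝ} {bbar : Fin n → ℝ} {ρ : ℝ}
    {p : (Fin n → Fin d → ℝ) × (Fin n → ℝ)} (hp : p ∈ goodData Abar bbar ρ)
    (x : EuclideanSpace ℝ (Fin d)) : (tight p.1 p.2 x).card ≤ d := by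
  by_contra! h
  exact hp.2 _ h ⟨x, fun i hi => mem_tight.1 hi⟩

lemma rowNormsLeOne_of_norm_eq_one {s : Fin n → EuclideanSpace ℝ (Fin d)} (hs : ∀ i, ‖s i‖ = 1) :
    RowNormsLeOne (fun i => (√2)⁻¹ • (s i).ofLp) (fun _ => (√2)⁻¹) := by
  intro i
  have h22 : √2 ^ 2 = (2 : ℝ) := Real.sq_sqrt (by norm_num)
  rw [Real.sqrt_le_one]
  have h1 := EuclideanSpace.norm_sq_eq (s i)
  simp only [Real.norm_eq_abs, sq_abs] at h1
  simp only [Pi.smul_apply, smul_eq_mul, mul_pow, ← Finset.mul_sum, inv_pow, h22]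
  rw [← h1, hs i]
  norm_num

lemma ofReal_le_combDist_of_forall_walk {P : Set (EuclideanSpace ℝ (Fin d))}
    {v w : Set.extremePoints ℝ P} {L : ℝ}
    (h : ∀ p : (skeletonGraph P).Walk v w, L ≤ p.length) :
    ENNReal.ofReal L ≤ (combDist P v w : ℝ≥0∞) := by
  by_cases htop : (skeletonGraph P).edist v w = ⊤
  · simp [combDist, htop]
  · obtain ⟨p, hp⟩ := SimpleGraph.exists_walk_of_edist_ne_top htop
    unfold combDist
    rw [← hp, ENat.toENNReal_coe]
    exact ENNReal.ofReal_le_of_le_toReal (by simpa using h p)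

lemma div_le_of_sq_le {u k : ℝ} (hd : 2 ≤ d) (hu : 0 < u) (hk : 0 ≤ k)
    (h : ((d : ℝ) - 1) ^ 2 ≤ 144 * (d * u) * k ^ 2) : √((d : ℝ) - 1) / (24 * √u) ≤ k := by
  have hd' : (2 : ℝ) ≤ d := by exact_mod_cast hd
  have hd1 : 0 < (d : ℝ) - 1 := by linarith
  have hsu : 0 < √u := Real.sqrt_pos.2 hu
  rw [div_le_iff₀ (by positivity), Real.sqrt_le_left (by positivity), mul_pow, mul_pow,
    Real.sq_sqrt hu.le]
  -- `d ≤ 2 (d - 1)` lets one factor `d - 1` cancel, leaving its square root in the bound.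
  have h1 : 144 * (d * u) * k ^ 2 ≤ 144 * ((2 * ((d : ℝ) - 1)) * u) * k ^ 2 := by
    gcongr
    linarith
  have h2 : ((d : ℝ) - 1) * ((d : ℝ) - 1) ≤ (288 * u * k ^ 2) * ((d : ℝ) - 1) := by linarith
  have h3 := le_of_mul_le_mul_right h2 hd1
  have : 0 ≤ u * k ^ 2 := by positivity
  linarith

/-- With high probability the smoothed polytope is bounded, and vertices that are optimal for
opposite objectives are far apart. -/
theorem exists_smoothed_polytope_far_apart {σ : ℝ} (hd : 2 ≤ d) (hσ : 0 < σ) (hσ1 : σ ≤ 1)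
    (hσd : σ * √(Real.log (4 / σ)) ≤ 1 / (32 * (d : ℝ))) (hn : n = ⌊(4 / σ) ^ d⌋₊) :
    ∃ (Abar : Fin n → Fin d → ℝ) (bbar : Fin n → ℝ),
      RowNormsLeOne Abar bbar ∧
      IsDenseOnSphere σ (Set.range fun i : Fin n => WithLp.toLp 2 (√2 • Abar i)) ∧
      (∀ i, √2 * bbar i = 1) ∧
      ∃ G : Set ((Fin n → Fin d → ℝ) × (Fin n → ℝ)), MeasurableSet G ∧
        1 - 1 / (n : ℝ) ^ d ≤ (smoothedLaw Abar bbar σ).real G ∧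
        ∀ p ∈ G, IsCompact (polyhedron p.1 p.2) ∧ (polyhedron p.1 p.2).Nonempty ∧
          ∀ c : EuclideanSpace ℝ (Fin d), c ≠ 0 →
            ∀ v w, IsMaximizer (polyhedron p.1 p.2) c v → IsMinimizer (polyhedron p.1 p.2) c w →
              ENNReal.ofReal (√((d : ℝ) - 1) / (24 * √(σ * √(Real.log (4 / σ))))) ≤
                (combDist (polyhedron p.1 p.2) v w : ℝ≥0∞) := by
  have hd' : (2 : ℝ) ≤ d := by exact_mod_cast hd
  have hlog := one_le_log_four_div hσ hσ1
  have hσ64 := le_one_div_sixty_four hd hσ hσ1 hσd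
  have hsqrt : 1 ≤ √(Real.log (4 / σ)) := Real.one_le_sqrt.2 hlog
  have h4σ : 4 ≤ 4 / σ := by rw [le_div_iff₀ hσ]; linarith
  have hnle : (n : ℝ) ≤ (4 / σ) ^ d := by rw [hn]; exact Nat.floor_le (by positivity)
  have hn0 : 0 < n := by
    rw [hn, Nat.floor_pos]; exact one_le_pow₀ (by linarith)
  have hnet : (1 + 2 / σ) ^ d < (n : ℝ) + 1 := by
    rw [hn]
    refine lt_of_le_of_lt ?_ (Nat.lt_floor_add_one _)
    gcongr
    have : (1 : ℝ) ≤ 2 / σ := by rw [le_div_iff₀ hσ]; linarith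
    calc 1 + 2 / σ ≤ 2 / σ + 2 / σ := by gcongr
      _ = 4 / σ := by ring
  obtain ⟨s, hs⟩ := exists_fin_isDenseOnSphere (by omega) hσ n hnet
  have hs1 : ∀ i, ‖s i‖ = 1 := fun i => by simpa using hs.1 ⟨i, rfl⟩
  obtain ⟨T, hT⟩ : ∃ T, T = d * (σ * √(Real.log (4 / σ))) := ⟨_, rfl⟩
  have hT0 : 0 ≤ T := by rw [hT]; positivity
  have hT32 : T ≤ 1 / 32 := by
    calc T ≤ d * (1 / (32 * (d : ℝ))) := by rw [hT]; gcongr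
      _ = 1 / 32 := by field_simp
  have hσT : σ ^ 2 ≤ T := by
    calc σ ^ 2 ≤ σ := by nlinarith
      _ ≤ σ * √(Real.log (4 / σ)) := le_mul_of_one_le_right hσ.le hsqrt
      _ ≤ T := by
        rw [hT]; exact le_mul_of_one_le_left (by positivity) (by linarith)
  -- The Chernoff parameter `4 d² log (4/σ)` corresponds to a row error of `2T`.
  have hρ : 4 * (d : ℝ) ^ 2 * Real.log (4 / σ) * σ ^ 2 = (2 * T) ^ 2 := by
    rw [hT, mul_pow, mul_pow, mul_pow, Real.sq_sqrt (by linarith)]; ring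
  have h2 : (√2 : ℝ) ≠ 0 := by positivity
  have hb : ∀ i : Fin n, √2 * (fun _ : Fin n => (√2)⁻¹) i = 1 := fun i => mul_inv_cancel₀ h2
  refine ⟨fun i => (√2)⁻¹ • (s i).ofLp, fun _ => (√2)⁻¹, rowNormsLeOne_of_norm_eq_one hs1, ?_, hb,
    goodData (fun i => (√2)⁻¹ • (s i).ofLp) (fun _ => (√2)⁻¹) ((2 * T) ^ 2),
    measurableSet_goodData _ _ _, ?_, ?_⟩
  · convert hs using 3 with i
    rw [smul_smul, mul_inv_cancel₀ h2, one_smul]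
  · rw [← hρ]
    refine le_trans ?_ (smoothedLaw_real_goodData _ _ hσ _)
    linarith [chernoff_union_le hd hσ hσ64 hn0 hnle]
  · intro p hp
    have hnear := norm_add_abs_le_of_mem_goodData hb hT0 hp
    refine ⟨isCompact_polyhedron_of_near_ball (η := 5 * T) hs hnear (by linarith) (by linarith),
      ⟨0, ?_⟩, fun c hc v w hv hw => ?_⟩
    · refine mem_polyhedron_of_norm_le (η := 4 * T) hs1 hnear le_rfl (by linarith) ?_
      rw [norm_zero]; linarith
    · refine ofReal_le_combDist_of_forall_walk fun q => ?_
      have h3 := sq_le_mul_length_sq_of_near_ball hd hs hnear hσT hT32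
        (fun x _ => card_tight_le_of_mem_goodData hp x) hc hv hw q
      rw [hT] at h3
      exact div_le_of_sq_le hd (by positivity) (Nat.cast_nonneg _) h3

/-- Comparison with an indicator function needs no measurability of `f`, here the shadow vertex
count. -/
lemma ofReal_div_four_le_lintegral {Ω : Type*} [MeasurableSpace Ω] {E : Type*} [MeasurableSpace E]
    {μ : Measure Ω} {ν : Measure E} [SFinite μ] [IsProbabilityMeasure ν] {G : Set Ω}
    (hG : MeasurableSet G) (hμG : ENNReal.ofReal (1 / 4) ≤ μ G) {L : ℝ≥0∞} {f : Ω × E → ℝ≥0∞}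
    (hf : ∀ᵐ ω ∂(μ.prod ν), ω.1 ∈ G → L ≤ f ω) :
    L * ENNReal.ofReal (1 / 4) ≤ ∫⁻ ω, f ω ∂(μ.prod ν) := by
  calc L * ENNReal.ofReal (1 / 4) ≤ L * μ G := by gcongr
    _ = ∫⁻ ω, (G ×ˢ Set.univ).indicator (fun _ => L) ω ∂(μ.prod ν) := by
      rw [lintegral_indicator_const (hG.prod MeasurableSet.univ), Measure.prod_prod, measure_univ,
        mul_one]
    _ ≤ _ := by
      refine lintegral_mono_ae (hf.mono fun ω hω => ?_)
      by_cases h : ω.1 ∈ G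
      · exact (Set.indicator_le_self' (fun _ _ => zero_le) _).trans (hω h)
      · rw [Set.indicator_of_notMem (fun h' => h h'.1)]
        exact zero_le

end Main

end

theorem mainTheorem4 (d : ℕ) (hd : 2 ≤ d) (σ : ℝ) (hσ : 0 < σ) (hσ1 : σ ≤ 1)
    (hσd : σ * √(Real.log (4 / σ)) ≤ 1 / (32 * (d : ℝ)))
    (n : ℕ) (hn : n = ⌊(4 / σ) ^ d⌋₊) :
    (∃ (Abar : Fin n → Fin d → ℝ) (bbar : Fin n → ℝ),
      RowNormsLeOne Abar bbar ∧
      IsDenseOnSphere σ (Set.range fun i : Fin n => WithLp.toLp 2 (√2 • Abar i)) ∧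
      (∀ i, √2 * bbar i = 1) ∧
      ∃ G : Set ((Fin n → Fin d → ℝ) × (Fin n → ℝ)), MeasurableSet G ∧
        1 - 1 / (n : ℝ) ^ d ≤ (smoothedLaw Abar bbar σ).real G ∧
        ∀ p ∈ G,
          ENNReal.ofReal (√((d : ℝ) - 1) / (24 * √(σ * √(Real.log (4 / σ))))) ≤
            (combDiam (polyhedron p.1 p.2) : ℝ≥0∞) ∧
          ∀ c : EuclideanSpace ℝ (Fin d), c ≠ 0 →
            (∃ v, IsMaximizer (polyhedron p.1 p.2) c v) ∧
            (∃ w, IsMinimizer (polyhedron p.1 p.2) c w) ∧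
            ∀ v w, IsMaximizer (polyhedron p.1 p.2) c v → IsMinimizer (polyhedron p.1 p.2) c w →
              ENNReal.ofReal (√((d : ℝ) - 1) / (24 * √(σ * √(Real.log (4 / σ))))) ≤
                (combDist (polyhedron p.1 p.2) v w : ℝ≥0∞)) ∧
    ∀ ν : Measure (EuclideanSpace ℝ (Fin d)), IsSphericallySymmetric ν →
      ENNReal.ofReal (√((d : ℝ) - 1) / (96 * √(σ * √(Real.log (4 / σ))))) ≤
        semiRandomShadowSize n d σ ν := by
  obtain ⟨Abar, bbar, hrow, hdense, hb, G, hG, hGprob, hgood⟩ :=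
    exists_smoothed_polytope_far_apart hd hσ hσ1 hσd hn
  have : Nonempty (Fin d) := ⟨⟨0, by omega⟩⟩
  -- Any unit vector serves, both as the objective witnessing the diameter and as the fixed
  -- objective of the shadow.
  obtain ⟨e, he⟩ := NormedSpace.sphere_nonempty (x := (0 : EuclideanSpace ℝ (Fin d))) (r := 1) |>.2
    zero_le_one
  have he1 : ‖e‖ = 1 := by simpa using he
  have he0 : e ≠ 0 := norm_ne_zero_iff.1 (by rw [he1]; exact one_ne_zero)
  refine ⟨⟨Abar, bbar, hrow, hdense, hb, G, hG, hGprob, fun p hp => ?_⟩, fun ν hν => ?_⟩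
  · obtain ⟨hcomp, hne, hfar⟩ := hgood p hp
    refine ⟨?_, fun c hc => ⟨exists_isMaximizer hcomp hne c, exists_isMinimizer hcomp hne c,
      hfar c hc⟩⟩
    obtain ⟨v, hv⟩ := exists_isMaximizer hcomp hne e
    obtain ⟨w, hw⟩ := exists_isMinimizer hcomp hne e
    refine (hfar e he0 v w hv hw).trans ?_
    exact_mod_cast (SimpleGraph.edist_le_ediam :
      (skeletonGraph (polyhedron p.1 p.2)).edist v w ≤ _)
  · have := hν.1
    have h4n : 4 ≤ (n : ℝ) ^ d := by
      have h4 : 4 ≤ n := by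
        rw [hn]
        apply Nat.le_floor
        have h4σ : 4 ≤ 4 / σ := by rw [le_div_iff₀ hσ]; linarith
        calc ((4 : ℕ) : ℝ) ≤ 4 / σ := by exact_mod_cast h4σ
          _ ≤ (4 / σ) ^ d := le_self_pow₀ (by linarith) (by omega)
      have h4' : (4 : ℝ) ≤ n := by exact_mod_cast h4
      exact h4'.trans (le_self_pow₀ (by linarith) (by omega))
    have hμG : ENNReal.ofReal (1 / 4) ≤ smoothedLaw Abar bbar σ G := by
      rw [ENNReal.ofReal_le_iff_le_toReal (measure_ne_top _ _)]
      have h1 : 1 / (n : ℝ) ^ d ≤ 1 / 4 := one_div_le_one_div_of_le (by norm_num) h4n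
      rw [measureReal_def] at hGprob
      linarith
    have hbound := ofReal_div_four_le_lintegral (ν := ν) hG hμG
      (L := ENNReal.ofReal (√((d : ℝ) - 1) / (24 * √(σ * √(Real.log (4 / σ))))))
      (f := fun ω => (shadowVertexCount (polyhedron ω.1.1 ω.1.2) e ω.2 : ℝ≥0∞))
      ((hν.ae_prod_isGenericDirection (smoothedLaw Abar bbar σ) e).mono fun ω hω hωG => by
        obtain ⟨hcomp, hne, hfar⟩ := hgood ω.1 hωG
        obtain ⟨v, w, hv, hw, hvw⟩ := exists_combDist_le_shadowVertexCount hcomp hne hω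
        exact (hfar e he0 v w hv hw).trans (by exact_mod_cast hvw))
    rw [← ENNReal.ofReal_mul (by positivity)] at hbound
    have heq : √((d : ℝ) - 1) / (96 * √(σ * √(Real.log (4 / σ)))) =
        √((d : ℝ) - 1) / (24 * √(σ * √(Real.log (4 / σ)))) * (1 / 4) := by
      rw [div_mul_div_comm]; ring_nf
    rw [heq]
    unfold semiRandomShadowSize
    exact hbound.trans (le_iSup_of_le Abar (le_iSup_of_le bbar (le_iSup_of_le e
      (le_iSup_of_le hrow (le_iSup_of_le he1 le_rfl)))))
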